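/- Let $d\ge 0$ and let $F:\mathbb R^d\to\mathbb R^d$, $x^*\in\mathbb R^d$ with $F(x^*)=0$, satisfy, for some $\mu>0$ and $L\ge 0$: - (quasi-strong monotonicity) $\langle F(x),x-x^*\rangle\ge \mu\|x-x^*\|^2$ for all $x\in\mathbb R^d$; - (smoothness) $F$ is $L$-Lipschitz and of class $C^4$, and $\sup_x\|\nabla^iF(x)\|<\infty$ for $i=1,\dots,4$. Let $(U_t)_{t\ge 0}$ be i.i.d. (jointly measurable) random fields $U_t:\mathbb R^d\to\mathbb R^d$ on a probability space such that, for some constants $\sigma>0$, $\kappa$, $G$: - there is a filtration $(\mathcal F_t)_{t\ge0}$ such that, for all $t$ and $x$, $U_t(x)$ is square-integrable and $\mathcal F_{t+1}$-measurable, $\mathbb E[U_t(x)\mid\mathcal F_t]=0$ and $\mathbb E[\|U_t(x)\|^2\mid\mathcal F_t]\le\sigma^2$ almost surely; - $U_t(x)=U_t^a(x)+U_t^b(x)$ with $U_t^a(x)$ and $U_t^b(x)$ independent, where $U_t^a(x)$ has a density $p_{t,x}$ with respect to Lebesgue measure and $\inf_{x\in C}p_{t,x}(v)>0$ for every bounded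 $C\subseteq\mathbb R^d$ and every $v\in\mathbb R^d$; - $\mathbb E\|U_t(x)\|^4<\kappa^4$ for all $t$ and $x$, and the covariance tensor $\mathcal C(x)=\mathbb E[U_t(x)^{\otimes 2}]$ is of class $C^3$ with $\|\mathcal C^{(i)}(x)\|<G$ for all $x$ and $i=1,2,3$. For a step-size $\gamma>0$ consider SGDA, $x_{t+1}=x_t-\gamma\,(F(x_t)+U_t(x_t))$, that is, the Markov chain on $\mathbb R^d$ with transition kernel $P_\gamma(x,B)=\mathbb P\big(x-\gamma(F(x)+U_t(x))\in B\big)$. Then there is $\theta>0$ such that: 1. for every $\gamma\in(0,\theta)$, SGDA has exactly one stationary distribution $\pi_\gamma$ (invariant probability measure of $P_\gamma$), and $\pi_\gamma$ has a finite first moment; 2. there are a vector $\Delta=\Delta(x^*)\in\mathbb R^d$ and a constant $K$, both independent of $\gamma$, such that for every $\gamma\in(0,\theta)$ $$\big\|\mathbb E_{x\sim\pi_\gamma}[x]-x^*-\gamma\,\Delta(x^*)\big\|\le K\gamma^2 ;$$ 3. consequently (Richardson–Romberg extrapolation) there is a constant $K'$ such that, whenever $\gamma>0$ and $2\gamma<\theta$,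 $$\big\|2\,\mathbb E_{x\sim\pi_\gamma}[x]-\mathbb E_{x\sim\pi_{2\gamma}}[x]-x^*\big\|\le K'\gamma^2 .$$ -/

import Mathlib

open MeasureTheory ProbabilityTheory
open scoped NNReal ENNReal

/-- The Euclidean space `ℝ^d`. -/
abbrev Eucl (d : ℕ) : Type := EuclideanSpace ℝ (Fin d)

/-- `F` is `lam`-weak `m`-quasi strongly monotone around `xs`:
`⟨F x, x - xs⟩ ≥ m ‖x - xs‖² - lam` for all `x`. -/
def WeakQuasiStronglyMonotone {d : ℕ} (F : Eucl d → Eucl d) (xs : Eucl d) (m lam : ℝ) : Prop :=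
  ∀ x, inner ℝ (F x) (x - xs) ≥ m * ‖x - xs‖ ^ 2 - lam

/-- `F` is `L`-Lipschitz and `C⁴`, with bounded derivatives of orders `1, …, 4`. -/
structure SmoothOperator {d : ℕ} (F : Eucl d → Eucl d) (L : ℝ≥0) : Prop where
  lipschitz : LipschitzWith L F
  contDiff : ContDiff ℝ 4 F
  bounded : ∀ i ∈ Finset.Icc 1 4, ∃ K : ℝ, ∀ x, ‖iteratedFDeriv ℝ i F x‖ ≤ K

/-- The noise of a stochastic oracle: `U t x` is the noise at time `t` and at the point `x`.
The random fields `U 0, U 1, …` are i.i.d. (their laws live on `Eucl d → Eucl d` with the product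
σ-algebra) and, for a filtration, each `U t x` is known at time `t + 1`, and has conditionally
on time `t` zero mean and second moment at most `σ²`. -/
structure OracleNoise {d : ℕ} {Ω : Type*} [mΩ : MeasurableSpace Ω] (P : Measure Ω)
    (U : ℕ → Eucl d → Ω → Eucl d) (σ : ℝ) : Prop where
  /-- joint measurability, so that the noise may be evaluated at a random point -/
  measurable : ∀ t, Measurable (fun p : Eucl d × Ω => U t p.1 p.2)
  indep : iIndepFun (fun t ω x => U t x ω) P
  identDistrib : ∀ t, IdentDistrib (fun ω x => U t x ω) (fun ω x => U 0 x ω) P P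
  memLp_two : ∀ t x, MemLp (U t x) 2 P
  filtration : ∃ ℱ : Filtration ℕ mΩ, ∀ t x,
    Measurable[ℱ (t + 1)] (U t x) ∧
    P[U t x | ℱ t] =ᵐ[P] (fun _ => 0) ∧
    P[fun ω => ‖U t x ω‖ ^ 2 | ℱ t] ≤ᵐ[P] (fun _ => σ ^ 2)

/-- The noise splits as a sum `Ua + Ub` of independent parts, the law of `Ua t x` having a
Lebesgue density `p t x` which, at each argument `v`, is bounded away from zero uniformly over
`x` in any bounded set. -/
def PositiveDensityComponent {d : ℕ} {Ω : Type*} [MeasurableSpace Ω] (P : Measure Ω)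
    (U : ℕ → Eucl d → Ω → Eucl d) : Prop :=
  ∃ (Ua Ub : ℕ → Eucl d → Ω → Eucl d) (p : ℕ → Eucl d → Eucl d → ℝ≥0∞), ∀ t,
    (∀ x, Measurable (Ua t x) ∧ Measurable (Ub t x) ∧ Measurable (p t x) ∧
      (∀ ω, U t x ω = Ua t x ω + Ub t x ω) ∧
      IndepFun (Ua t x) (Ub t x) P ∧
      P.map (Ua t x) = (volume : Measure (Eucl d)).withDensity (p t x)) ∧
    ∀ C : Set (Eucl d), Bornology.IsBounded C → ∀ v, 0 < ⨅ x ∈ C, p t x v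

/-- The entries `𝔼[V(x)_i V(x)_j]` of the covariance tensor of a centred random field `V`. -/
noncomputable def covTensor {d : ℕ} {Ω : Type*} [MeasurableSpace Ω] (P : Measure Ω)
    (V : Eucl d → Ω → Eucl d) (x : Eucl d) : Fin d → Fin d → ℝ :=
  fun i j => ∫ ω, V x ω i * V x ω j ∂P

/-- Fourth moments of the noise below `κ⁴`, and a `C³` covariance tensor whose derivatives of
orders `1, 2, 3` are bounded by `G`. -/
structure RegularNoise {d : ℕ} {Ω : Type*} [MeasurableSpace Ω] (P : Measure Ω)
    (U : ℕ → Eucl d → Ω → Eucl d) (κ G : ℝ) : Prop where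
  integrable_four : ∀ t x, Integrable (fun ω => ‖U t x ω‖ ^ 4) P
  fourth_moment : ∀ t x, ∫ ω, ‖U t x ω‖ ^ 4 ∂P < κ ^ 4
  cov_contDiff : ∀ t, ContDiff ℝ 3 (covTensor P (U t))
  cov_bounded : ∀ t, ∀ i ∈ Finset.Icc 1 3, ∀ x, ‖iteratedFDeriv ℝ i (covTensor P (U t)) x‖ < G

/-- The transition kernel of one step `x ↦ x - γ (F x + V x)` of stochastic gradient
descent-ascent, with fresh noise `V`. (`Kernel.map` is the zero kernel if the step is not
measurable; see `sgdaKernel_apply` for the formula.) -/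
noncomputable def sgdaKernel {d : ℕ} {Ω : Type*} [MeasurableSpace Ω] (P : Measure Ω)
    (F : Eucl d → Eucl d) (V : Eucl d → Ω → Eucl d) (γ : ℝ) : Kernel (Eucl d) (Eucl d) :=
  (Kernel.id ×ₖ Kernel.const (Eucl d) P).map (fun p => p.1 - γ • (F p.1 + V p.1 p.2))

theorem sgdaKernel_apply {d : ℕ} {Ω : Type*} [MeasurableSpace Ω] (P : Measure Ω)
    [IsProbabilityMeasure P] (F : Eucl d → Eucl d) (hF : Measurable F) (V : Eucl d → Ω → Eucl d)
    (hV : Measurable (fun p : Eucl d × Ω => V p.1 p.2)) (γ : ℝ) (x : Eucl d) (B : Set (Eucl d))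
    (hB : MeasurableSet B) :
    sgdaKernel P F V γ x B = P {ω | x - γ • (F x + V x ω) ∈ B} := by
  have hm : Measurable (fun p : Eucl d × Ω => p.1 - γ • (F p.1 + V p.1 p.2)) := by
    fun_prop
  rw [sgdaKernel, Kernel.map_apply' _ hm _ hB, Kernel.prod_apply, Kernel.id_apply,
    Kernel.const_apply, Measure.dirac_prod, Measure.map_apply (by fun_prop) (hm hB)]
  rfl

/-- `π` is a stationary distribution of SGDA with operator `F`, noise fields `U t` and constant
step-size `γ`: a probability measure that is invariant under the transition kernel (at each
time `t`; the kernels agree for identically distributed noise). -/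
structure SGDAStationary {d : ℕ} {Ω : Type*} [MeasurableSpace Ω] (P : Measure Ω)
    (F : Eucl d → Eucl d) (U : ℕ → Eucl d → Ω → Eucl d) (γ : ℝ) (π : Measure (Eucl d)) :
    Prop where
  isProbabilityMeasure : IsProbabilityMeasure π
  invariant : ∀ t, Kernel.Invariant (sgdaKernel P F (U t) γ) π

/-! ### Limits of measures and oscillation of functions -/

section Harris

open Filter Topology

variable {X : Type*} [MeasurableSpace X]

/-! Write z = x - x*. For small γ the function ‖z‖⁴ is a Lyapunov function: one step multiplies its
mean by at most 1 - γμ/2, up to an error of order γ³. On its sublevel sets the density part of the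
noise gives a local Dobrushin condition (`exists_uniform_charge`): each measurable set or its
complement is charged uniformly in the starting point. Harris' theorem, proved by contracting
weighted oscillations (`HarrisCondition.exists_contraction`), yields a unique invariant law.
Dividing γ³ by the contraction rate γμ/2 shows that its fourth moment is O(γ²).

The expansion comes from testing stationarity on monomials in z. If g = F + U is the increment, z
and z - γg have the same law, so degrees one, two and three give E F_i = 0, E(F_i z_j + F_j z_i) = γ
E(F_i F_j + C_ij), E(F_i z_j z_k + ...) = γ E((F_i F_j + C_ij) z_k + ...) - γ² r, with r bounded.
With F replaced by its Taylor polynomial at x*, the leading part of each left side is a Lyapunov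
operator built from A = ∇F(x*), acting on the tensor of moments of that degree. Quasi-strong
monotonicity makes A coercive, so these operators are invertible.

The hierarchy closes because the fourth moment is O(γ²): it controls every Taylor remainder. The
mean is O(γ) (`exists_momentOne_le`). Hence the signed third moments are O(γ²)
(`exists_momentThree_le`), beyond what absolute moments give. Hence the second moments are γS +
O(γ²), where S solves the Lyapunov equation with right side C(x*) (`exists_momentTwo_sub_le`). Hence
the mean is γΔ + O(γ²), where AΔ is minus the contraction of ½∇²F(x*) with S
(`exists_momentOne_sub_le`). Extrapolation cancels the term γΔ. -/

/-- A sequence of probability measures that is Cauchy uniformly over all measurable sets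
converges, uniformly over all measurable sets, to a probability measure. -/
theorem exists_probabilityMeasure_of_uniform_cauchy (μ : ℕ → Measure X)
    [∀ n, IsProbabilityMeasure (μ n)] (ε : ℕ → ℝ) (hε : Tendsto ε atTop (𝓝 0))
    (h : ∀ n k A, MeasurableSet A → |(μ (n + k)).real A - (μ n).real A| ≤ ε n) :
    ∃ π : Measure X, IsProbabilityMeasure π ∧
      ∀ n A, MeasurableSet A → |π.real A - (μ n).real A| ≤ ε n := by
  have hc : ∀ A, MeasurableSet A → CauchySeq (fun n => (μ n).real A) := by
    intro A hA
    refine cauchySeq_of_le_tendsto_0 (fun n => 2 * ε n) ?_ (by simpa using hε.const_mul 2)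
    intro n m N hn hm
    obtain ⟨a, rfl⟩ := Nat.exists_eq_add_of_le hn
    obtain ⟨b, rfl⟩ := Nat.exists_eq_add_of_le hm
    have h1 := abs_le.1 (h N a A hA)
    have h2 := abs_le.1 (h N b A hA)
    rw [Real.dist_eq, abs_le]
    constructor <;> linarith
  have hl : ∀ A, ∃ l : ℝ, MeasurableSet A → Tendsto (fun n => (μ n).real A) atTop (𝓝 l) := by
    intro A
    by_cases hA : MeasurableSet A
    · obtain ⟨l, hl⟩ := cauchySeq_tendsto_of_complete (hc A hA)
      exact ⟨l, fun _ => hl⟩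
    · exact ⟨0, fun h => absurd h hA⟩
  choose l hl using hl
  have hl0 : ∀ A, MeasurableSet A → 0 ≤ l A := fun A hA =>
    ge_of_tendsto' (hl A hA) fun n => measureReal_nonneg
  have hlε : ∀ n A, MeasurableSet A → |l A - (μ n).real A| ≤ ε n := by
    intro n A hA
    have h1 : Tendsto (fun k => |(μ (n + k)).real A - (μ n).real A|) atTop
        (𝓝 |l A - (μ n).real A|) := by
      refine Tendsto.abs (Tendsto.sub_const ?_ _)
      simpa [add_comm] using (tendsto_add_atTop_iff_nat n).2 (hl A hA)
    exact le_of_tendsto' h1 fun k => h n k A hA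
  -- Countable additivity survives the limit because the error ε n is the same for a finite partial
  -- union and for the whole union: fix n first, then use countable additivity of μ n.
  have hsum : ∀ f : ℕ → Set X, (∀ i, MeasurableSet (f i)) → Pairwise (Function.onFun Disjoint f) →
      HasSum (fun i => l (f i)) (l (⋃ i, f i)) := by
    intro f hf hd
    have hU := MeasurableSet.iUnion hf
    rw [hasSum_iff_tendsto_nat_of_nonneg (fun i => hl0 _ (hf i))]
    have hfin : ∀ N, ∑ i ∈ Finset.range N, l (f i) = l (⋃ i ∈ Finset.range N, f i) := by
      intro N
      refine tendsto_nhds_unique (tendsto_finsetSum _ fun i _ => hl _ (hf i)) ?_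
      have := hl _ (Finset.measurableSet_biUnion (Finset.range N) fun i _ => hf i)
      refine this.congr fun n => ?_
      rw [measureReal_biUnion_finset (fun i _ j _ hij => hd hij) (fun i _ => hf i)]
    rw [Metric.tendsto_atTop]
    intro e he
    obtain ⟨n, hn⟩ := (Metric.tendsto_atTop.1 hε (e / 3) (by positivity))
    have hn := hn n le_rfl
    rw [Real.dist_eq, sub_zero] at hn
    have h2 : Tendsto (fun N => ∑ i ∈ Finset.range N, (μ n).real (f i)) atTop
        (𝓝 ((μ n).real (⋃ i, f i))) := by
      have hs : HasSum (fun i => (μ n).real (f i)) ((μ n).real (⋃ i, f i)) := by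
        have hne : ∑' i, μ n (f i) ≠ ∞ := by
          rw [← measure_iUnion hd hf]; exact measure_ne_top (μ n) _
        rw [measureReal_def, measure_iUnion hd hf,
          ENNReal.tsum_toReal_eq fun i => measure_ne_top (μ n) _]
        exact ENNReal.hasSum_toReal hne
      exact hs.tendsto_sum_nat
    obtain ⟨N0, hN0⟩ := Metric.tendsto_atTop.1 h2 (e / 3) (by positivity)
    refine ⟨N0, fun N hN => ?_⟩
    have h3 := hN0 N hN
    rw [← measureReal_biUnion_finset (fun i _ j _ hij => hd hij) (fun i _ => hf i),
      Real.dist_eq] at h3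
    rw [hfin, Real.dist_eq]
    have h4 := abs_le.1
      (hlε n _ (Finset.measurableSet_biUnion (Finset.range N) fun i _ => hf i))
    have h5 := abs_le.1 (hlε n _ hU)
    have h6 := abs_lt.1 h3
    have h7 := abs_lt.1 hn
    rw [abs_lt]
    constructor <;> linarith
  have hempty : l ∅ = 0 := by
    refine tendsto_nhds_unique (hl ∅ MeasurableSet.empty) ?_
    simp
  have huniv : l Set.univ = 1 := by
    refine tendsto_nhds_unique (hl _ MeasurableSet.univ) ?_
    simp
  let π : Measure X := Measure.ofMeasurable (fun A _ => ENNReal.ofReal (l A))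
    (by simp [hempty]) (by
      intro f hf hd
      rw [← (hsum f hf hd).tsum_eq,
        ENNReal.ofReal_tsum_of_nonneg (fun i => hl0 _ (hf i)) (hsum f hf hd).summable])
  have hπ : ∀ A, MeasurableSet A → π A = ENNReal.ofReal (l A) := fun A hA =>
    Measure.ofMeasurable_apply A hA
  refine ⟨π, ⟨by rw [hπ _ MeasurableSet.univ, huniv, ENNReal.ofReal_one]⟩, fun n A hA => ?_⟩
  rw [measureReal_def, hπ A hA, ENNReal.toReal_ofReal (hl0 A hA)]
  exact hlε n A hA

/-- Two probability measures that are uniformly close on measurable sets have close integrals of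
bounded functions. -/
theorem abs_integral_sub_integral_le_of_measureReal {π μ : Measure X} [IsProbabilityMeasure π]
    [IsProbabilityMeasure μ] {ε : ℝ}
    (h : ∀ A, MeasurableSet A → |π.real A - μ.real A| ≤ ε) {φ : X → ℝ} (hφ : Measurable φ)
    {M : ℝ} (h0 : ∀ x, 0 ≤ φ x) (hM : ∀ x, φ x ≤ M) :
    |∫ x, φ x ∂π - ∫ x, φ x ∂μ| ≤ ε * M := by
  have hM0 : 0 ≤ M := by
    obtain ⟨x⟩ : Nonempty X := nonempty_of_isProbabilityMeasure π
    exact (h0 x).trans (hM x)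
  have hint : ∀ ν : Measure X, [IsProbabilityMeasure ν] → Integrable φ ν := fun ν _ =>
    Integrable.of_bound hφ.aestronglyMeasurable M
      (Eventually.of_forall fun x => by rw [Real.norm_eq_abs, abs_of_nonneg (h0 x)]; exact hM x)
  have hanti : ∀ ν : Measure X, [IsProbabilityMeasure ν] →
      IntegrableOn (fun t => ν.real {a | t ≤ φ a}) (Set.Ioc 0 M) := by
    intro ν _
    refine Integrable.of_bound (C := 1) ?_ (Eventually.of_forall fun t => ?_)
    · refine Measurable.aestronglyMeasurable ?_
      refine Antitone.measurable fun s t hst => measureReal_mono fun a ha => ?_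
      exact hst.trans ha
    · rw [Real.norm_eq_abs, abs_of_nonneg measureReal_nonneg]
      exact measureReal_le_one
  -- Layer-cake formula: both integrals become integrals over levels t in (0, M] of measures of sets
  -- {t ≤ φ}, which differ by at most ε.
  rw [(hint π).integral_eq_integral_Ioc_meas_le (Eventually.of_forall h0)
      (Eventually.of_forall hM),
    (hint μ).integral_eq_integral_Ioc_meas_le (Eventually.of_forall h0)
      (Eventually.of_forall hM), ← integral_sub (hanti π) (hanti μ)]
  have := norm_setIntegral_le_of_norm_le_const (μ := volume) (s := Set.Ioc 0 M) (C := ε)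
    (f := fun t => π.real {a | t ≤ φ a} - μ.real {a | t ≤ φ a}) (by simp)
    (fun t _ => h _ (measurableSet_le measurable_const hφ))
  simpa [hM0] using this

/-- A function whose oscillation is bounded by a sum of weights is, up to a constant, bounded by
the weight. -/
theorem exists_forall_abs_sub_le_of_osc {X : Type*} [Nonempty X] {φ W : X → ℝ}
    (h : ∀ x y, φ x - φ y ≤ W x + W y) : ∃ c, ∀ x, |φ x - c| ≤ W x := by
  have hb : ∀ y, ∀ x, φ x - W x ≤ φ y + W y := fun y x => by linarith [h x y]
  -- The hypothesis says that each φ x - W x lies below each φ y + W y, so the supremum of the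
  -- former separates the two families.
  refine ⟨⨆ x, (φ x - W x), fun x => ?_⟩
  have hbdd : BddAbove (Set.range fun x => φ x - W x) :=
    ⟨φ x + W x, by rintro _ ⟨y, rfl⟩; exact hb x y⟩
  have h1 := le_ciSup hbdd x
  have h2 : ⨆ x, (φ x - W x) ≤ φ x + W x := ciSup_le (hb x)
  rw [abs_le]
  constructor <;> linarith

end Harris

/-! ### Contraction of weighted oscillations -/

section Harris

open Filter Topology

variable {X : Type*} [MeasurableSpace X]

/-- The hypotheses of Harris' theorem: a Lyapunov function `V` with a geometric drift, and a
local Dobrushin condition on the sublevel set `{V ≤ R}`. -/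
structure HarrisCondition (κ : Kernel X X) (V : X → ℝ) (lam b R α : ℝ) : Prop where
  measurable : Measurable V
  nonneg : ∀ x, 0 ≤ V x
  integrable : ∀ x, Integrable V (κ x)
  drift : ∀ x, ∫ y, V y ∂κ x ≤ lam * V x + b
  lam_nonneg : 0 ≤ lam
  lam_lt_one : lam < 1
  b_nonneg : 0 ≤ b
  R_pos : 0 < R
  b_le : 4 * b ≤ (1 - lam) * R
  α_pos : 0 < α
  α_le_one : α ≤ 1
  dichotomy : ∀ A, MeasurableSet A →
    (∀ x, V x ≤ R → α ≤ (κ x).real A) ∨ (∀ x, V x ≤ R → α ≤ (κ x).real Aᶜ)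

/-- A measurable function with values in `[-1, 1]` has small oscillation after one step of the
kernel, on the set where the Dobrushin condition holds. -/
theorem HarrisCondition.integral_sub_integral_le {κ : Kernel X X} [IsMarkovKernel κ] {V : X → ℝ}
    {lam b R α : ℝ} (H : HarrisCondition κ V lam b R α) {φ : X → ℝ} (hφ : Measurable φ)
    (h1 : ∀ x, |φ x| ≤ 1) {x y : X} (hx : V x ≤ R) (hy : V y ≤ R) :
    ∫ z, φ z ∂κ x - ∫ z, φ z ∂κ y ≤ 2 - α := by
  have hi : ∀ x, Integrable φ (κ x) := fun x =>
    Integrable.of_bound hφ.aestronglyMeasurable 1 (Eventually.of_forall h1)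
  -- The dichotomy is applied to the set where φ is nonnegative: the difference is at most κ x (A) +
  -- κ y (Aᶜ), and one of these two masses is at most 1 - α.
  have hA : MeasurableSet {z | 0 ≤ φ z} := measurableSet_le measurable_const hφ
  have hup : ∀ x, ∫ z, φ z ∂κ x ≤ (κ x).real {z | 0 ≤ φ z} := by
    intro x
    rw [← integral_indicator_one hA]
    refine integral_mono (hi x) ((integrable_const (1 : ℝ)).indicator hA) fun z => ?_
    by_cases hz : 0 ≤ φ z
    · simpa [Set.indicator, hz] using (abs_le.1 (h1 z)).2
    · simpa [Set.indicator, hz] using (not_le.1 hz).le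
  have hlow : ∀ x, - (κ x).real {z | 0 ≤ φ z}ᶜ ≤ ∫ z, φ z ∂κ x := by
    intro x
    rw [← integral_indicator_one hA.compl, ← integral_neg]
    refine integral_mono ((integrable_const (1 : ℝ)).indicator hA.compl).neg (hi x) fun z => ?_
    by_cases hz : 0 ≤ φ z
    · simp [Set.indicator, hz]
    · simpa [Set.indicator, hz] using (abs_le.1 (h1 z)).1
  have hc : ∀ x, (κ x).real {z | 0 ≤ φ z}ᶜ = 1 - (κ x).real {z | 0 ≤ φ z} := fun x => by
    rw [measureReal_compl hA]; simp
  have e1 := hup x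
  have e2 := hlow y
  have e3 : (κ x).real {z | 0 ≤ φ z} ≤ 1 := measureReal_le_one
  have e4 : (κ y).real {z | 0 ≤ φ z}ᶜ ≤ 1 := measureReal_le_one
  rcases H.dichotomy _ hA with h | h
  · have := h y hy
    linarith [hc y]
  · have := h x hx
    linarith [hc x]

/-- One step of a kernel that satisfies Harris' conditions contracts weighted oscillations. -/
theorem HarrisCondition.exists_contraction [Nonempty X] {κ : Kernel X X} [IsMarkovKernel κ]
    {V : X → ℝ} {lam b R α : ℝ} (H : HarrisCondition κ V lam b R α) :
    ∃ β q : ℝ, 0 < β ∧ 0 ≤ q ∧ q < 1 ∧ ∀ (φ : X → ℝ) (r M : ℝ), Measurable φ →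
      (∀ x, |φ x| ≤ M) → 0 ≤ r → (∀ x y, φ x - φ y ≤ r * (2 + β * V x + β * V y)) →
      ∀ x y, ∫ z, φ z ∂κ x - ∫ z, φ z ∂κ y ≤ r * q * (2 + β * V x + β * V y) := by
  obtain ⟨hVm, hV0, hVi, hd, hl0, hl1, hb, hR, hbR, hα, hα1, -⟩ := id H
  -- The weight of V is small enough that the drift error 2βb from two starting points consumes at
  -- most half of the Dobrushin gain α.
  obtain ⟨β, hβ, hβb⟩ : ∃ β : ℝ, 0 < β ∧ 4 * (β * b) ≤ α := by
    refine ⟨α / (4 * b + 1), by positivity, ?_⟩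
    rw [div_mul_eq_mul_div, mul_div_assoc', div_le_iff₀ (by positivity)]
    nlinarith
  -- The relative gain when V x + V y > R: there the drift removes at least (1 - lam)/2 · βS, with S
  -- = V x + V y, and βS/(2 + βS) increases with S.
  set η : ℝ := (1 - lam) / 2 * (β * R) / (2 + β * R) with hη
  have hη0 : 0 < η := by have : 0 < 1 - lam := by linarith
                         positivity
  have hη1 : η ≤ 1 := by
    rw [hη, div_le_one (by positivity)]
    nlinarith [mul_pos hβ hR]
  set q : ℝ := max (max lam (1 - α / 4)) (1 - η) with hq
  refine ⟨β, q, hβ, hl0.trans ((le_max_left _ _).trans (le_max_left _ _)),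
    max_lt (max_lt hl1 (by linarith)) (by linarith), ?_⟩
  have q1 : lam ≤ q := (le_max_left _ _).trans (le_max_left _ _)
  have q2 : 1 - α / 4 ≤ q := (le_max_right _ _).trans (le_max_left _ _)
  have q3 : 1 - η ≤ q := le_max_right _ _
  intro φ r M hφ hM hr hosc x y
  have hVx := hV0 x
  have hVy := hV0 y
  obtain ⟨c, hc⟩ := exists_forall_abs_sub_le_of_osc (φ := φ) (W := fun x => r * (1 + β * V x))
    (fun x y => by linarith [hosc x y])
  have hi : ∀ x, Integrable φ (κ x) := fun x =>
    Integrable.of_bound hφ.aestronglyMeasurable M (Eventually.of_forall hM)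
  have hWi : ∀ x, Integrable (fun z => r * (1 + β * V z)) (κ x) := fun x =>
    ((integrable_const (1 : ℝ)).add ((hVi x).const_mul β)).const_mul r
  have hWint : ∀ x, ∫ z, r * (1 + β * V z) ∂κ x ≤ r * (1 + β * (lam * V x + b)) := by
    intro x
    rw [integral_const_mul, integral_add (integrable_const _) ((hVi x).const_mul β),
      integral_const_mul]
    simp only [integral_const, probReal_univ, smul_eq_mul, one_mul]
    gcongr
    exact hd x
  have hsub : ∀ x, ∫ z, (φ z - c) ∂κ x = ∫ z, φ z ∂κ x - c := fun x => by
    rw [integral_sub (hi x) (integrable_const c)]; simp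
  by_cases hS : V x + V y ≤ R
  -- Near the centre, φ - c is cut at height r. The bounded part contracts by the Dobrushin
  -- condition, and the excess is at most rβV, which contracts by the drift.
  · set f : X → ℝ := fun z => max (-r) (min r (φ z - c)) with hf
    have hfm : Measurable f := by fun_prop
    have hfb : ∀ z, |f z| ≤ r := fun z => abs_le.2
      ⟨le_max_left _ _, max_le (by linarith) (min_le_left _ _)⟩
    have hfi : ∀ x, Integrable f (κ x) := fun x =>
      Integrable.of_bound hfm.aestronglyMeasurable r (Eventually.of_forall hfb)
    have hgb : ∀ z, |(φ z - c) - f z| ≤ r * (β * V z) := by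
      intro z
      have h1 := abs_le.1 (hc z)
      have h2 : 0 ≤ r * (β * V z) := by have := hV0 z; positivity
      simp only [hf]
      rw [abs_le]
      rcases le_total (φ z - c) r with h3 | h3
      · rw [min_eq_right h3]
        rcases le_total (-r) (φ z - c) with h4 | h4
        · rw [max_eq_right h4]; constructor <;> linarith
        · rw [max_eq_left h4]; constructor <;> linarith
      · rw [min_eq_left h3, max_eq_right (by linarith)]; constructor <;> linarith
    have hg : ∀ x, |∫ z, ((φ z - c) - f z) ∂κ x| ≤ r * (β * (lam * V x + b)) := by
      intro x
      refine (norm_integral_le_of_norm_le (f := fun z => (φ z - c) - f z)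
        (((hVi x).const_mul β).const_mul r) (Eventually.of_forall hgb)).trans ?_
      rw [integral_const_mul, integral_const_mul]
      gcongr
      exact hd x
    have hg' : ∀ x, ∫ z, ((φ z - c) - f z) ∂κ x = ∫ z, φ z ∂κ x - c - ∫ z, f z ∂κ x := fun x => by
      rw [← hsub]
      exact integral_sub ((hi x).sub (integrable_const c)) (hfi x)
    have hfo : ∫ z, f z ∂κ x - ∫ z, f z ∂κ y ≤ r * (2 - α) := by
      rcases hr.eq_or_lt with h0 | h0
      · have : ∀ z, f z = 0 := fun z => by
          have := hfb z; rw [← h0] at this; exact abs_nonpos_iff.1 this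
        simp [this, ← h0]
      · have := H.integral_sub_integral_le (φ := fun z => r⁻¹ * f z) (by fun_prop)
          (fun z => by
            rw [abs_mul, abs_of_pos (inv_pos.2 h0), inv_mul_le_iff₀ h0, mul_one]; exact hfb z)
          (x := x) (y := y) (by linarith) (by linarith)
        rw [integral_const_mul, integral_const_mul, ← mul_sub, inv_mul_le_iff₀ h0] at this
        exact this
    have gx := abs_le.1 (hg x)
    have gy := abs_le.1 (hg y)
    rw [hg'] at gx gy
    have key : (2 - α) + β * (lam * V x + b) + β * (lam * V y + b)
        ≤ q * (2 + β * V x + β * V y) := by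
      have e1 : lam * (β * (V x + V y)) ≤ q * (β * (V x + V y)) := by gcongr
      linarith
    calc _ ≤ r * ((2 - α) + β * (lam * V x + b) + β * (lam * V y + b)) := by linarith
      _ ≤ r * (q * (2 + β * V x + β * V y)) := by gcongr
      _ = _ := by ring
  -- Far from the centre the drift suffices, because `b_le` makes the additive constant 2b at most
  -- (1 - lam)/2 times V x + V y.
  · push Not at hS
    have hb1 : ∀ x, |∫ z, (φ z - c) ∂κ x| ≤ r * (1 + β * (lam * V x + b)) := fun x =>
      (norm_integral_le_of_norm_le (f := fun z => φ z - c) (hWi x)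
        (Eventually.of_forall hc)).trans (hWint x)
    have bx := abs_le.1 (hb1 x)
    have hby := abs_le.1 (hb1 y)
    rw [hsub] at bx hby
    have key : 2 + β * (lam * V x + b) + β * (lam * V y + b)
        ≤ q * (2 + β * V x + β * V y) := by
      set S := V x + V y with hS'
      have e0 : 0 < β * S := mul_pos hβ (by linarith)
      have e1 : (1 - η) * (2 + β * S) ≤ q * (2 + β * S) := by gcongr
      have e2 : 2 * b ≤ (1 - lam) / 2 * S := by nlinarith
      have e3 : η * (2 + β * S) ≤ (1 - lam) / 2 * (β * S) := by
        rw [hη, div_mul_eq_mul_div, div_le_iff₀ (by positivity)]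
        have : β * R ≤ β * S := by gcongr
        have h5 : (0 : ℝ) ≤ (1 - lam) / 2 := by linarith
        have : (β * R) * (2 + β * S) ≤ β * S * (2 + β * R) := by nlinarith
        nlinarith
      have e4 : β * (2 * b) ≤ β * ((1 - lam) / 2 * S) := by gcongr
      have : q * (2 + β * V x + β * V y) = q * (2 + β * S) := by rw [hS']; ring
      rw [this]
      have : β * (lam * V x + b) + β * (lam * V y + b) = β * lam * S + β * (2 * b) := by
        rw [hS']; ring
      linarith
    calc _ ≤ r * (2 + β * (lam * V x + b) + β * (lam * V y + b)) := by linarith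
      _ ≤ r * (q * (2 + β * V x + β * V y)) := by gcongr
      _ = _ := by ring

end Harris

/-! ### Harris' theorem: existence and uniqueness of the invariant law -/

section Harris

open Filter Topology

variable {X : Type*} [MeasurableSpace X]

/-- The action of a kernel on functions. -/
noncomputable def kernelAverage (κ : Kernel X X) (φ : X → ℝ) (x : X) : ℝ := ∫ y, φ y ∂κ x

theorem measurable_kernelAverage {κ : Kernel X X} [IsMarkovKernel κ] {φ : X → ℝ}
    (hφ : Measurable φ) : Measurable (kernelAverage κ φ) :=
  (hφ.stronglyMeasurable.integral_kernel (κ := κ)).measurable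

theorem kernelAverage_mem_Icc {κ : Kernel X X} [IsMarkovKernel κ] {φ : X → ℝ}
    (hφ : Measurable φ) (h : ∀ x, φ x ∈ Set.Icc (0 : ℝ) 1) (x : X) :
    kernelAverage κ φ x ∈ Set.Icc (0 : ℝ) 1 := by
  refine ⟨integral_nonneg fun y => (h y).1, ?_⟩
  have hi : Integrable φ (κ x) := Integrable.of_bound hφ.aestronglyMeasurable 1
    (Eventually.of_forall fun y => by rw [Real.norm_eq_abs, abs_of_nonneg (h y).1]; exact (h y).2)
  have := integral_mono hi (integrable_const (1 : ℝ)) fun y => (h y).2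
  simpa [kernelAverage] using this

theorem iterate_kernelAverage {κ : Kernel X X} [IsMarkovKernel κ] {φ : X → ℝ}
    (hφ : Measurable φ) (h : ∀ x, φ x ∈ Set.Icc (0 : ℝ) 1) (n : ℕ) :
    Measurable ((kernelAverage κ)^[n] φ) ∧
      ∀ x, (kernelAverage κ)^[n] φ x ∈ Set.Icc (0 : ℝ) 1 := by
  induction n with
  | zero => exact ⟨hφ, h⟩
  | succ n ih =>
    rw [Function.iterate_succ_apply']
    exact ⟨measurable_kernelAverage ih.1, kernelAverage_mem_Icc ih.1 ih.2⟩

theorem integrable_of_mem_Icc {μ : Measure X} [IsFiniteMeasure μ] {φ : X → ℝ}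
    (hφ : Measurable φ) (h : ∀ x, φ x ∈ Set.Icc (0 : ℝ) 1) : Integrable φ μ :=
  Integrable.of_bound hφ.aestronglyMeasurable 1
    (Eventually.of_forall fun y => by rw [Real.norm_eq_abs, abs_of_nonneg (h y).1]; exact (h y).2)

theorem integral_bind_eq_integral_kernelAverage {κ : Kernel X X} [IsMarkovKernel κ]
    {μ : Measure X} [IsProbabilityMeasure μ] {φ : X → ℝ} (hφ : Integrable φ (μ.bind κ)) :
    ∫ x, φ x ∂(μ.bind κ) = ∫ x, kernelAverage κ φ x ∂μ := by
  rw [Measure.comp_eq_comp_const_apply] at hφ ⊢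
  rw [Kernel.integral_comp hφ, Kernel.const_apply]
  rfl

/-- The law after `n` steps of the chain started at `x`. -/
noncomputable def iterLaw (κ : Kernel X X) (x : X) : ℕ → Measure X
  | 0 => Measure.dirac x
  | n + 1 => (iterLaw κ x n).bind κ

instance (κ : Kernel X X) [IsMarkovKernel κ] (x : X) (n : ℕ) :
    IsProbabilityMeasure (iterLaw κ x n) := by
  induction n with
  | zero => unfold iterLaw; infer_instance
  | succ n ih => unfold iterLaw; infer_instance

/-- Chapman–Kolmogorov in dual form. It moves the last n steps onto the test function, where the
oscillation contraction acts. -/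
theorem integral_iterLaw_add {κ : Kernel X X} [IsMarkovKernel κ] {φ : X → ℝ}
    (hφ : Measurable φ) (h : ∀ x, φ x ∈ Set.Icc (0 : ℝ) 1) (x : X) (k n : ℕ) :
    ∫ y, φ y ∂(iterLaw κ x (k + n)) = ∫ y, (kernelAverage κ)^[n] φ y ∂(iterLaw κ x k) := by
  induction n generalizing φ with
  | zero => rfl
  | succ n ih =>
    rw [Function.iterate_succ_apply,
      ← ih (measurable_kernelAverage hφ) (kernelAverage_mem_Icc hφ h), ← add_assoc, iterLaw,
      integral_bind_eq_integral_kernelAverage (integrable_of_mem_Icc hφ h)]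

theorem integral_iterate_kernelAverage_of_invariant {κ : Kernel X X} [IsMarkovKernel κ]
    {ν : Measure X} [IsProbabilityMeasure ν] (hν : Kernel.Invariant κ ν) {φ : X → ℝ}
    (hφ : Measurable φ) (h : ∀ x, φ x ∈ Set.Icc (0 : ℝ) 1) (n : ℕ) :
    ∫ y, (kernelAverage κ)^[n] φ y ∂ν = ∫ y, φ y ∂ν := by
  induction n generalizing φ with
  | zero => rfl
  | succ n ih =>
    rw [Function.iterate_succ_apply, ih (measurable_kernelAverage hφ) (kernelAverage_mem_Icc hφ h)]
    conv_rhs => rw [← hν.def]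
    have : IsProbabilityMeasure (ν.bind κ) := by rw [hν.def]; infer_instance
    rw [integral_bind_eq_integral_kernelAverage (integrable_of_mem_Icc hφ h)]

/-- The bound is the fixed point of t ↦ lam · t + b, and the chain starts below it, at V = 0. -/
theorem HarrisCondition.integral_iterLaw_le {κ : Kernel X X} [IsMarkovKernel κ] {V : X → ℝ}
    {lam b R α : ℝ} (H : HarrisCondition κ V lam b R α) {x : X} (hx : V x = 0) (n : ℕ) :
    Integrable V (iterLaw κ x n) ∧ ∫ y, V y ∂(iterLaw κ x n) ≤ b / (1 - lam) := by
  have h1 : 0 < 1 - lam := by linarith [H.lam_lt_one]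
  induction n with
  | zero =>
    refine ⟨integrable_dirac' H.measurable.stronglyMeasurable (by simp), ?_⟩
    rw [iterLaw, integral_dirac' _ _ H.measurable.stronglyMeasurable, hx]
    exact div_nonneg H.b_nonneg h1.le
  | succ n ih =>
    have hup : Integrable (fun y => lam * V y + b) (iterLaw κ x n) :=
      (ih.1.const_mul lam).add (integrable_const b)
    have hav : Integrable (kernelAverage κ V) (iterLaw κ x n) :=
      hup.mono' (measurable_kernelAverage H.measurable).aestronglyMeasurable
        (Eventually.of_forall fun y => by
          rw [Real.norm_eq_abs, kernelAverage, abs_of_nonneg (integral_nonneg H.nonneg)]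
          exact H.drift y)
    have hi : Integrable V (iterLaw κ x (n + 1)) := by
      rw [iterLaw, Measure.integrable_comp_iff H.measurable.aestronglyMeasurable]
      refine ⟨Eventually.of_forall H.integrable, ?_⟩
      simp only [Real.norm_eq_abs, abs_of_nonneg (H.nonneg _)]
      exact hav
    refine ⟨hi, ?_⟩
    have e : ∫ y, V y ∂(iterLaw κ x (n + 1)) = ∫ y, kernelAverage κ V y ∂(iterLaw κ x n) :=
      integral_bind_eq_integral_kernelAverage hi
    rw [e]
    calc _ ≤ ∫ y, (lam * V y + b) ∂(iterLaw κ x n) := integral_mono hav hup fun y => H.drift y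
      _ = lam * ∫ y, V y ∂(iterLaw κ x n) + b := by
        rw [integral_add (ih.1.const_mul lam) (integrable_const b), integral_const_mul]; simp
      _ ≤ lam * (b / (1 - lam)) + b := by gcongr; exacts [H.lam_nonneg, ih.2]
      _ = b / (1 - lam) := by field_simp; ring

/-- **Harris' theorem**: a kernel with a Lyapunov function and a local Dobrushin condition has
exactly one invariant probability measure, and the Lyapunov function is integrable for it. -/
theorem HarrisCondition.exists_unique_invariant {κ : Kernel X X} [IsMarkovKernel κ] {V : X → ℝ}
    {lam b R α : ℝ} (H : HarrisCondition κ V lam b R α) {x₀ : X} (hx₀ : V x₀ = 0) :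
    ∃ π : Measure X, IsProbabilityMeasure π ∧ Kernel.Invariant κ π ∧ Integrable V π ∧
      ∫ x, V x ∂π ≤ b / (1 - lam) ∧
      ∀ ν : Measure X, IsProbabilityMeasure ν → Kernel.Invariant κ ν → ν = π := by
  have : Nonempty X := ⟨x₀⟩
  obtain ⟨β, q, hβ, hq0, hq1, hcon⟩ := H.exists_contraction
  set D : ℝ := b / (1 - lam) with hD
  have hD0 : 0 ≤ D := div_nonneg H.b_nonneg (by linarith [H.lam_lt_one])
  -- A function with values in [0, 1] has oscillation at most 1, below the weight 2 + βV x + βV y,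
  -- and each step gains a factor q.
  have hosc : ∀ φ : X → ℝ, Measurable φ → (∀ x, φ x ∈ Set.Icc (0 : ℝ) 1) → ∀ n x y,
      (kernelAverage κ)^[n] φ x - (kernelAverage κ)^[n] φ y ≤
        q ^ n * (2 + β * V x + β * V y) := by
    intro φ hφ h n
    induction n with
    | zero =>
      intro x y
      have := (h x).2
      have := (h y).1
      have := mul_nonneg hβ.le (H.nonneg x)
      have := mul_nonneg hβ.le (H.nonneg y)
      simp only [Function.iterate_zero, id, pow_zero]
      linarith
    | succ n ih =>
      intro x y
      rw [Function.iterate_succ_apply', pow_succ]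
      have hn := iterate_kernelAverage (κ := κ) hφ h n
      exact hcon _ (q ^ n) 1 hn.1
        (fun x => by rw [abs_of_nonneg (hn.2 x).1]; exact (hn.2 x).2) (by positivity) ih x y
  have hint : ∀ φ : X → ℝ, Measurable φ → (∀ x, φ x ∈ Set.Icc (0 : ℝ) 1) →
      ∀ ν : Measure X, IsProbabilityMeasure ν → Integrable V ν → ∀ n x,
      |∫ y, (kernelAverage κ)^[n] φ y ∂ν - (kernelAverage κ)^[n] φ x| ≤
        q ^ n * (2 + β * ∫ y, V y ∂ν + β * V x) := by
    intro φ hφ h ν _ hV n x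
    have hn := iterate_kernelAverage (κ := κ) hφ h n
    have hi : Integrable ((kernelAverage κ)^[n] φ) ν := integrable_of_mem_Icc hn.1 hn.2
    have e1 : ∫ y, (kernelAverage κ)^[n] φ y ∂ν - (kernelAverage κ)^[n] φ x =
        ∫ y, ((kernelAverage κ)^[n] φ y - (kernelAverage κ)^[n] φ x) ∂ν := by
      rw [integral_sub hi (integrable_const _)]; simp
    have e2 : q ^ n * (2 + β * ∫ y, V y ∂ν + β * V x) =
        ∫ y, q ^ n * (2 + β * V y + β * V x) ∂ν := by
      have e3 : ∫ y, (2 + β * V y + β * V x) ∂ν = ∫ y, (2 + β * V y) ∂ν + ∫ _, β * V x ∂ν :=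
        integral_add ((integrable_const _).add (hV.const_mul β)) (integrable_const _)
      rw [integral_const_mul, e3, integral_add (integrable_const _) (hV.const_mul β),
        integral_const_mul]
      simp
    rw [e1, e2]
    refine norm_integral_le_of_norm_le
      (f := fun y => (kernelAverage κ)^[n] φ y - (kernelAverage κ)^[n] φ x)
      ((((integrable_const _).add (hV.const_mul β)).add (integrable_const _)).const_mul _)
      (Eventually.of_forall fun y => ?_)
    rw [Real.norm_eq_abs, abs_le]
    constructor <;> linarith [hosc φ hφ h n x y, hosc φ hφ h n y x]
  have hind : ∀ A : Set X, MeasurableSet A → Measurable (A.indicator (1 : X → ℝ)) ∧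
      ∀ x, A.indicator (1 : X → ℝ) x ∈ Set.Icc (0 : ℝ) 1 := by
    intro A hA
    refine ⟨measurable_one.indicator hA, fun x => ?_⟩
    by_cases hx : x ∈ A <;> simp [hx]
  have hε : Tendsto (fun n => q ^ n * (2 + β * D)) atTop (𝓝 0) := by
    simpa using (tendsto_pow_atTop_nhds_zero_of_lt_one hq0 hq1).mul_const (2 + β * D)
  -- The laws at times n + k and n are compared by taking the law at time k as initial measure in
  -- `hint`; its V-mean is at most D for every k.
  obtain ⟨π, hπ, hlim⟩ := exists_probabilityMeasure_of_uniform_cauchy (iterLaw κ x₀) _ hε (by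
    intro n k A hA
    obtain ⟨h1, h2⟩ := hind A hA
    have e := hint _ h1 h2 (iterLaw κ x₀ k) inferInstance (H.integral_iterLaw_le hx₀ k).1 n x₀
    rw [← integral_iterLaw_add h1 h2, add_comm k n, integral_indicator_one hA] at e
    have e2 := integral_iterLaw_add (κ := κ) h1 h2 x₀ 0 n
    rw [zero_add, integral_indicator_one hA, iterLaw, integral_dirac' _ _
      (iterate_kernelAverage h1 h2 n).1.stronglyMeasurable] at e2
    rw [← e2, hx₀, mul_zero, add_zero] at e
    refine e.trans ?_
    gcongr
    exact (H.integral_iterLaw_le hx₀ k).2)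
  have hlimint : ∀ φ : X → ℝ, Measurable φ → (∀ x, 0 ≤ φ x) → ∀ M, (∀ x, φ x ≤ M) →
      Tendsto (fun n => ∫ x, φ x ∂(iterLaw κ x₀ n)) atTop (𝓝 (∫ x, φ x ∂π)) := by
    intro φ hφ h0 M hM
    rw [tendsto_iff_norm_sub_tendsto_zero]
    refine squeeze_zero (fun _ => norm_nonneg _) (fun n => ?_)
      (by simpa using hε.mul_const M)
    rw [norm_sub_rev]
    exact abs_integral_sub_integral_le_of_measureReal (hlim n) hφ h0 hM
  have hinv : Kernel.Invariant κ π := by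
    refine Measure.ext fun A hA => ?_
    obtain ⟨h1, h2⟩ := hind A hA
    have : IsProbabilityMeasure (π.bind κ) := inferInstance
    rw [← measureReal_eq_measureReal_iff, ← integral_indicator_one hA, ← integral_indicator_one hA,
      integral_bind_eq_integral_kernelAverage (integrable_of_mem_Icc h1 h2)]
    have t1 := hlimint _ (measurable_kernelAverage (κ := κ) h1)
      (fun x => (kernelAverage_mem_Icc h1 h2 x).1) 1 (fun x => (kernelAverage_mem_Icc h1 h2 x).2)
    have t2 := (tendsto_add_atTop_iff_nat 1).2 (hlimint _ h1 (fun x => (h2 x).1) 1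
      (fun x => (h2 x).2))
    refine tendsto_nhds_unique t1 (t2.congr fun n => ?_)
    rw [iterLaw, integral_bind_eq_integral_kernelAverage (integrable_of_mem_Icc h1 h2)]
  -- Setwise convergence only passes bounded functions to the limit, so V is truncated at N and
  -- recovered by monotone convergence.
  have hVπ : ∀ N : ℕ, ∫ x, min (V x) N ∂π ≤ D := by
    intro N
    refine le_of_tendsto' (hlimint (fun x => min (V x) N) (H.measurable.min measurable_const)
      (fun x => le_min (H.nonneg x) N.cast_nonneg) N (fun x => min_le_right _ _)) fun n => ?_
    obtain ⟨h1, h2⟩ := H.integral_iterLaw_le hx₀ n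
    refine le_trans (integral_mono_of_nonneg (Eventually.of_forall fun x =>
      le_min (H.nonneg x) N.cast_nonneg) h1 (Eventually.of_forall fun x => min_le_left _ _)) h2
  have hVl : ∫⁻ x, ENNReal.ofReal (V x) ∂π ≤ ENNReal.ofReal D := by
    have e : ∀ x, ENNReal.ofReal (V x) = ⨆ N : ℕ, ENNReal.ofReal (min (V x) N) := by
      intro x
      refine le_antisymm ?_ (iSup_le fun N => ENNReal.ofReal_le_ofReal (min_le_left _ _))
      obtain ⟨N, hN⟩ := exists_nat_ge (V x)
      exact le_iSup_of_le N (by rw [min_eq_left hN])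
    simp_rw [e]
    rw [lintegral_iSup (fun N => (H.measurable.min measurable_const).ennreal_ofReal)
      (fun N N' h x => ENNReal.ofReal_le_ofReal (min_le_min_left _ (by exact_mod_cast h)))]
    refine iSup_le fun N => ?_
    rw [← ofReal_integral_eq_lintegral_ofReal _
      (Eventually.of_forall fun x => le_min (H.nonneg x) N.cast_nonneg)]
    · exact ENNReal.ofReal_le_ofReal (hVπ N)
    · refine Integrable.of_bound (H.measurable.min measurable_const).aestronglyMeasurable N
        (Eventually.of_forall fun x => ?_)
      rw [Real.norm_eq_abs, abs_of_nonneg (le_min (H.nonneg x) N.cast_nonneg)]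
      exact min_le_right _ _
  have hVint : Integrable V π := by
    refine ⟨H.measurable.aestronglyMeasurable, ?_⟩
    rw [hasFiniteIntegral_iff_ofReal (Eventually.of_forall H.nonneg)]
    exact hVl.trans_lt ENNReal.ofReal_lt_top
  refine ⟨π, hπ, hinv, hVint, ?_, ?_⟩
  · rw [← ofReal_integral_eq_lintegral_ofReal hVint (Eventually.of_forall H.nonneg)] at hVl
    exact (ENNReal.ofReal_le_ofReal_iff hD0).1 hVl
  · intro ν _ hν
    refine Measure.ext fun A hA => ?_
    obtain ⟨h1, h2⟩ := hind A hA
    rw [← measureReal_eq_measureReal_iff, ← integral_indicator_one hA, ← integral_indicator_one hA]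
    -- V is not known to be ν-integrable, so ν cannot be fed to `hint`. Instead the averages
    -- converge at each point to the π-measure of A, and dominated convergence integrates this
    -- against ν.
    have hpt : ∀ x, Tendsto (fun n => (kernelAverage κ)^[n] (A.indicator 1) x) atTop
        (𝓝 (∫ x, A.indicator (1 : X → ℝ) x ∂π)) := by
      intro x
      rw [tendsto_iff_norm_sub_tendsto_zero]
      have t : Tendsto (fun n => q ^ n * (2 + β * ∫ y, V y ∂π + β * V x)) atTop (𝓝 0) := by
        simpa using (tendsto_pow_atTop_nhds_zero_of_lt_one hq0 hq1).mul_const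
          (2 + β * ∫ y, V y ∂π + β * V x)
      refine squeeze_zero (fun _ => norm_nonneg _) (fun n => ?_) t
      have := hint _ h1 h2 π hπ hVint n x
      rwa [integral_iterate_kernelAverage_of_invariant hinv h1 h2, abs_sub_comm] at this
    have t := tendsto_integral_of_dominated_convergence (μ := ν) (fun _ => (1 : ℝ))
      (fun n => (iterate_kernelAverage (κ := κ) h1 h2 n).1.aestronglyMeasurable)
      (integrable_const _)
      (fun n => Eventually.of_forall fun x => by
        have := (iterate_kernelAverage (κ := κ) h1 h2 n).2 x
        rw [Real.norm_eq_abs, abs_of_nonneg this.1]; exact this.2)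
      (Eventually.of_forall hpt)
    simp_rw [integral_iterate_kernelAverage_of_invariant hν h1 h2] at t
    have := tendsto_nhds_unique t tendsto_const_nhds
    simpa using this.symm

end Harris

/-! ### Local Dobrushin condition from the density of the noise -/

section Minorization

open Filter Topology

/-- A family of measurable functions with positive pointwise infimum has a positive measurable
almost everywhere lower bound: an essential infimum is attained along a countable subfamily. -/
theorem exists_measurable_pos_forall_ae_le {E ι : Type*} [MeasurableSpace E] (μ : Measure E)
    [SFinite μ] (C : Set ι) (p : ι → E → ℝ≥0∞) (hp : ∀ i ∈ C, Measurable (p i))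
    (hpos : ∀ v, 0 < ⨅ i ∈ C, p i v) :
    ∃ g : E → ℝ≥0∞, Measurable g ∧ (∀ v, 0 < g v) ∧ (∀ v, g v ≤ 1) ∧
      ∀ i ∈ C, g ≤ᵐ[μ] p i := by
  -- An infimum over an uncountable family need not be measurable. Countable subfamilies S are used,
  -- and the cap 1 keeps the integrals over an equivalent finite measure finite, so that a
  -- minimising T exists.
  set G : Set ι → E → ℝ≥0∞ := fun S v => min 1 (⨅ i ∈ S, p i v) with hG
  have hGm : ∀ S, S ⊆ C → S.Countable → Measurable (G S) := fun S hS hc =>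
    measurable_const.min (Measurable.biInf S hc fun i hi => hp i (hS hi))
  have hGanti : ∀ S T, S ⊆ T → ∀ v, G T v ≤ G S v := fun S T h v =>
    min_le_min_left _ (biInf_mono fun i hi => h hi)
  set Φ : Set ι → ℝ≥0∞ := fun S => ∫⁻ v, G S v ∂μ.toFinite with hΦ
  set 𝒮 : Set ℝ≥0∞ := Φ '' {S | S ⊆ C ∧ S.Countable} with h𝒮
  have hne : 𝒮.Nonempty := ⟨Φ ∅, ∅, ⟨Set.empty_subset _, Set.countable_empty⟩, rfl⟩
  obtain ⟨u, -, hu, hmem⟩ := exists_seq_tendsto_sInf hne (OrderBot.bddBelow 𝒮)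
  choose S hS hSu using hmem
  set T : Set ι := ⋃ n, S n with hT
  have hTC : T ⊆ C := Set.iUnion_subset fun n => (hS n).1
  have hTc : T.Countable := Set.countable_iUnion fun n => (hS n).2
  have hΦT : Φ T ≤ sInf 𝒮 := ge_of_tendsto' hu fun n => by
    rw [← hSu n]
    exact lintegral_mono (hGanti _ _ (Set.subset_iUnion S n))
  refine ⟨G T, hGm T hTC hTc, fun v => lt_min one_pos
    ((hpos v).trans_le (biInf_mono fun i hi => hTC hi)), fun v => min_le_left _ _, fun i hi => ?_⟩
  have hsub : insert i T ⊆ C := Set.insert_subset hi hTC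
  have hle : Φ T ≤ Φ (insert i T) :=
    hΦT.trans (sInf_le ⟨_, ⟨hsub, hTc.insert i⟩, rfl⟩)
  have hfin : Φ (insert i T) ≠ ∞ := by
    refine ne_top_of_le_ne_top ?_ (lintegral_mono (g := fun _ => 1) fun v => min_le_left _ _)
    simp
  -- By minimality of T, adding one index i does not lower the integral, hence changes the infimum
  -- only on a null set.
  have hae : G (insert i T) =ᵐ[μ.toFinite] G T :=
    ae_eq_of_ae_le_of_lintegral_le
      (Eventually.of_forall (hGanti _ _ (Set.subset_insert i T))) hfin
      (hGm T hTC hTc).aemeasurable hle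
  filter_upwards [(absolutelyContinuous_toFinite μ).ae_le hae] with v hv
  rw [← hv]
  exact (min_le_right _ _).trans (biInf_le (fun i => p i v) (Set.mem_insert i T))

/-- A positive density gives uniformly positive mass to bounded sets of volume at least `q`. -/
theorem exists_pos_le_withDensity {E : Type*} [MeasurableSpace E] {μ : Measure E} {g : E → ℝ≥0∞}
    (hg : Measurable g) (hg0 : ∀ v, 0 < g v) (hg1 : ∀ v, g v ≤ 1) {B : Set E}
    (hBm : MeasurableSet B) (hB : μ B ≠ ∞) {q : ℝ≥0∞} (hq : q ≠ 0) :
    ∃ c : ℝ≥0∞, 0 < c ∧ ∀ A, MeasurableSet A → A ⊆ B → q ≤ μ A → c ≤ μ.withDensity g A := by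
  have hfm : Measurable (B.indicator fun v => (g v)⁻¹) := hg.inv.indicator hBm
  have hmul : g * (B.indicator fun v => (g v)⁻¹) = B.indicator 1 := by
    funext v
    by_cases hv : v ∈ B
    · simp [hv, ENNReal.mul_inv_cancel (hg0 v).ne' ((hg1 v).trans_lt ENNReal.one_lt_top).ne]
    · simp [hv]
  -- Absolute continuity of the integral of 1/g on B with respect to g dμ: that integral over A ⊆ B
  -- is μ A, so a small g-mass would force μ A < q.
  obtain ⟨c, hc, h⟩ := exists_pos_setLIntegral_lt_of_measure_lt (μ := μ.withDensity g)
    (f := B.indicator fun v => (g v)⁻¹) (by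
      rw [lintegral_withDensity_eq_lintegral_mul _ hg hfm, hmul, lintegral_indicator_one hBm]
      exact hB) hq
  refine ⟨c, hc, fun A hA hAB hqA => ?_⟩
  by_contra! hlt
  have := h A hlt
  rw [setLIntegral_withDensity_eq_setLIntegral_mul _ hg hfm hA, hmul,
    lintegral_indicator_one hBm, Measure.restrict_apply hBm,
    Set.inter_eq_self_of_subset_right hAB] at this
  exact absurd hqA (not_le.2 this)

/-- If `U = a + b` is the sum of independent random vectors, and `a` has a given chance to be
small, then `b` is tight as soon as `U` has a second moment. -/
theorem measure_norm_gt_mul_le_of_indepFun {Ω E : Type*} [MeasurableSpace Ω] {P : Measure Ω}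
    [IsProbabilityMeasure P] [NormedAddCommGroup E] [MeasurableSpace E] [BorelSpace E]
    {a b U : Ω → E} (hind : IndepFun a b P) (hU : ∀ ω, U ω = a ω + b ω) {σ R : ℝ} (hR : 1 < R)
    (hint : Integrable (fun ω => ‖U ω‖ ^ 2) P)
    (hσ : ∫ ω, ‖U ω‖ ^ 2 ∂P ≤ σ ^ 2) :
    (R - 1) ^ 2 * (P.real {ω | ‖a ω‖ < 1} * P.real {ω | R < ‖b ω‖}) ≤ σ ^ 2 := by
  have h1 : P.real {ω | ‖a ω‖ < 1} * P.real {ω | R < ‖b ω‖} =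
      P.real ({ω | ‖a ω‖ < 1} ∩ {ω | R < ‖b ω‖}) := by
    rw [measureReal_def, measureReal_def, measureReal_def, ← ENNReal.toReal_mul]
    congr 1
    exact (hind.measure_inter_preimage_eq_mul {v | ‖v‖ < 1} {v | R < ‖v‖}
      (measurableSet_lt measurable_norm measurable_const)
      (measurableSet_lt measurable_const measurable_norm)).symm
  have h2 : {ω | ‖a ω‖ < 1} ∩ {ω | R < ‖b ω‖} ⊆ {ω | (R - 1) ^ 2 ≤ ‖U ω‖ ^ 2} := by
    rintro ω ⟨ha, hb⟩
    have ha : ‖a ω‖ < 1 := ha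
    have hb : R < ‖b ω‖ := hb
    have h3 : ‖b ω‖ ≤ ‖U ω‖ + ‖a ω‖ := by
      have : b ω = U ω - a ω := by rw [hU]; abel
      rw [this]; exact norm_sub_le _ _
    show (R - 1) ^ 2 ≤ ‖U ω‖ ^ 2
    exact pow_le_pow_left₀ (by linarith) (by linarith) 2
  have h3 := mul_meas_ge_le_integral_of_nonneg (μ := P)
    (Eventually.of_forall fun ω => by positivity) hint ((R - 1) ^ 2)
  rw [h1]
  refine le_trans ?_ (h3.trans hσ)
  exact mul_le_mul_of_nonneg_left (measureReal_mono h2) (by positivity)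

/-- A local Dobrushin condition for shifts of a noise with a positive density component: for each
measurable set, either it or its complement is charged uniformly over the index set. -/
theorem exists_uniform_charge {d : ℕ} {Ω ι : Type*} [MeasurableSpace Ω] {P : Measure Ω}
    [IsProbabilityMeasure P] {C : Set ι} {a b U : ι → Ω → Eucl d} {p : ι → Eucl d → ℝ≥0∞}
    (ha : ∀ x ∈ C, Measurable (a x)) (hb : ∀ x ∈ C, Measurable (b x))
    (hp : ∀ x ∈ C, Measurable (p x)) (hU : ∀ x ∈ C, ∀ ω, U x ω = a x ω + b x ω)
    (hind : ∀ x ∈ C, IndepFun (a x) (b x) P)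
    (hmap : ∀ x ∈ C, P.map (a x) = volume.withDensity (p x))
    (hpos : ∀ v, 0 < ⨅ x ∈ C, p x v) {σ : ℝ}
    (hint : ∀ x ∈ C, Integrable (fun ω => ‖U x ω‖ ^ 2) P)
    (hσ : ∀ x ∈ C, ∫ ω, ‖U x ω‖ ^ 2 ∂P ≤ σ ^ 2) {s : ι → Eucl d} {M : ℝ}
    (hs : ∀ x ∈ C, ‖s x‖ ≤ M) {γ : ℝ} (hγ : 0 < γ) :
    ∃ α : ℝ, 0 < α ∧ α ≤ 1 ∧ ∀ A, MeasurableSet A →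
      (∀ x ∈ C, α ≤ P.real {ω | s x - γ • U x ω ∈ A}) ∨
      (∀ x ∈ C, α ≤ P.real {ω | s x - γ • U x ω ∈ Aᶜ}) := by
  rcases C.eq_empty_or_nonempty with rfl | ⟨x₀, hx₀⟩
  · exact ⟨1, one_pos, le_rfl, by simp⟩
  have hM : 0 ≤ M := (norm_nonneg _).trans (hs x₀ hx₀)
  obtain ⟨g, hgm, hg0, hg1, hgp⟩ := exists_measurable_pos_forall_ae_le
    (volume : Measure (Eucl d)) C p hp hpos
  set ν : Measure (Eucl d) := volume.withDensity g with hν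
  have hνa : ∀ x ∈ C, ∀ S, ν S ≤ P.map (a x) S := fun x hx S => by
    rw [hmap x hx]; exact withDensity_mono (hgp x hx) S
  have hB1 : MeasurableSet (Metric.ball (0 : Eucl d) 1) := measurableSet_ball
  have hvol : (volume : Measure (Eucl d)) (Metric.ball 0 1) ≠ 0 :=
    (Metric.measure_ball_pos volume 0 one_pos).ne'
  -- the chance of `a` to be small
  obtain ⟨δ, hδ, hδν⟩ := exists_pos_le_withDensity (μ := volume) hgm hg0 hg1 hB1
    measure_ball_lt_top.ne hvol
  have hδ1 := hδν _ hB1 subset_rfl le_rfl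
  have hδa : ∀ x ∈ C, δ ≤ P {ω | ‖a x ω‖ < 1} := fun x hx => by
    have := hδ1.trans (hνa x hx _)
    rw [Measure.map_apply (ha x hx) hB1] at this
    refine this.trans (measure_mono fun ω hω => ?_)
    simpa using hω
  have hδtop : δ ≠ ∞ := ne_top_of_le_ne_top (measure_ne_top P _) (hδa x₀ hx₀)
  have hδr : 0 < δ.toReal := ENNReal.toReal_pos hδ.ne' hδtop
  -- No moment of `b` is assumed; its tightness comes from that of U and from the chance at least δ
  -- that `a` is small. The value of R makes (R - 1)δ exceed 2σ², so the tail is at most 1/2.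
  obtain ⟨R, hR1, hRb⟩ : ∃ R : ℝ, 1 < R ∧ ∀ x ∈ C, (1 / 2 : ℝ) ≤ P.real {ω | ‖b x ω‖ ≤ R} := by
    refine ⟨2 * σ ^ 2 / δ.toReal + 2, by have : 0 ≤ 2 * σ ^ 2 / δ.toReal := by positivity
                                         linarith, fun x hx => ?_⟩
    set r : ℝ := 2 * σ ^ 2 / δ.toReal + 1 with hr
    have hr1 : 1 ≤ r := by have : 0 ≤ 2 * σ ^ 2 / δ.toReal := by positivity
                           linarith
    have h1 := measure_norm_gt_mul_le_of_indepFun (hind x hx) (hU x hx) (R := r + 1) (by linarith)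
      (hint x hx) (hσ x hx)
    have h2 : δ.toReal ≤ P.real {ω | ‖a x ω‖ < 1} :=
      ENNReal.toReal_mono (measure_ne_top P _) (hδa x hx)
    have h3 : P.real {ω | ‖b x ω‖ ≤ r + 1} = 1 - P.real {ω | r + 1 < ‖b x ω‖} := by
      have : {ω | ‖b x ω‖ ≤ r + 1} = {ω | r + 1 < ‖b x ω‖}ᶜ := by ext ω; simp
      rw [this, measureReal_compl (measurableSet_lt measurable_const (hb x hx).norm)]; simp
    have e : 2 * σ ^ 2 / δ.toReal + 2 = r + 1 := by rw [hr]; ring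
    rw [e, h3]
    set y := P.real {ω | r + 1 < ‖b x ω‖}
    have hy : 0 ≤ y := measureReal_nonneg
    have h4 : r * δ.toReal = 2 * σ ^ 2 + δ.toReal := by rw [hr]; field_simp
    have h5 : r * δ.toReal * y ≤ σ ^ 2 := by
      calc r * δ.toReal * y ≤ (r + 1 - 1) ^ 2 * (P.real {ω | ‖a x ω‖ < 1} * y) := by
            rw [mul_assoc]
            gcongr
            nlinarith
        _ ≤ σ ^ 2 := h1
    by_contra! hlt
    nlinarith [sq_nonneg σ]
  -- the density part charges every large subset of the unit ball
  set ρ : ℝ := (M + γ * R + 1) / γ with hρ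
  set q : ℝ≥0∞ := ENNReal.ofReal |(γ ^ d)⁻¹| * (volume (Metric.ball (0 : Eucl d) 1) / 2) with hq
  have hq0 : q ≠ 0 := by
    refine mul_ne_zero ?_ ?_
    · rw [ne_eq, ENNReal.ofReal_eq_zero, not_le]
      positivity
    · exact (ENNReal.half_pos hvol).ne'
  obtain ⟨c, hc, hcν⟩ := exists_pos_le_withDensity (μ := volume) hgm hg0 hg1
    (measurableSet_closedBall (x := (0 : Eucl d)) (ε := ρ)) measure_closedBall_lt_top.ne hq0
  have key : ∀ A : Set (Eucl d), MeasurableSet A → volume (Metric.ball (0 : Eucl d) 1) / 2 ≤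
      volume (A ∩ Metric.ball 0 1) → ∀ x ∈ C, c * 2⁻¹ ≤ P {ω | s x - γ • U x ω ∈ A} := by
    intro A hA hAv x hx
    -- With b frozen at u, the step is affine in `a`, and pulling a set back multiplies its volume
    -- by γ⁻ᵈ; q is that factor times half the volume of the unit ball.
    have hpart : ∀ u : Eucl d, ‖u‖ ≤ R → c ≤ P.map (a x) {v | s x - γ • (v + u) ∈ A} := by
      intro u hu
      set A' : Set (Eucl d) := {v | s x - γ • (v + u) ∈ A ∩ Metric.ball 0 1} with hA'
      have hA'm : MeasurableSet A' :=
        (by fun_prop : Measurable fun v : Eucl d => s x - γ • (v + u)) (hA.inter hB1)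
      have hvolA' : volume A' = ENNReal.ofReal |(γ ^ d)⁻¹| * volume (A ∩ Metric.ball 0 1) := by
        have e : A' = (fun v => v + u) ⁻¹' ((γ • ·) ⁻¹' ((fun v => s x - v) ⁻¹'
            (A ∩ Metric.ball 0 1))) := rfl
        rw [e, measure_preimage_add_right, Measure.addHaar_preimage_smul _ hγ.ne',
          (Measure.measurePreserving_sub_left volume (s x)).measure_preimage
            (hA.inter hB1).nullMeasurableSet]
        simp
      refine (hcν A' hA'm ?_ ?_).trans ((hνa x hx A').trans (measure_mono fun v hv => hv.1))
      · intro v hv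
        have h1 : ‖s x - γ • (v + u)‖ < 1 := by simpa using hv.2
        have h2 : γ • v = s x - γ • u - (s x - γ • (v + u)) := by rw [smul_add]; abel
        have h3 : γ * ‖v‖ ≤ M + γ * R + 1 := by
          calc γ * ‖v‖ = ‖γ • v‖ := by rw [norm_smul, Real.norm_of_nonneg hγ.le]
            _ ≤ ‖s x‖ + ‖γ • u‖ + ‖s x - γ • (v + u)‖ := by
              rw [h2]; exact (norm_sub_le _ _).trans (by gcongr; exact norm_sub_le _ _)
            _ ≤ M + γ * R + 1 := by
              rw [norm_smul, Real.norm_of_nonneg hγ.le]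
              have := hs x hx
              gcongr
        rw [mem_closedBall_zero_iff, hρ, le_div_iff₀ hγ]
        linarith
      · rw [hvolA', hq]
        gcongr
    have hm : Measurable fun z : Eucl d × Eucl d => s x - γ • (z.2 + z.1) := by fun_prop
    have hmA : MeasurableSet {z : Eucl d × Eucl d | s x - γ • (z.2 + z.1) ∈ A} := hm hA
    have hprod : P {ω | s x - γ • U x ω ∈ A} =
        ((P.map (b x)).prod (P.map (a x))) {z | s x - γ • (z.2 + z.1) ∈ A} := by
      rw [← (indepFun_iff_map_prod_eq_prod_map_map (hb x hx).aemeasurable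
        (ha x hx).aemeasurable).1 (hind x hx).symm,
        Measure.map_apply ((hb x hx).prodMk (ha x hx)) hmA]
      congr 1
      ext ω
      simp [hU x hx]
    have : IsProbabilityMeasure (P.map (a x)) :=
      Measure.isProbabilityMeasure_map (ha x hx).aemeasurable
    rw [hprod, Measure.prod_apply hmA]
    have hball : P.map (b x) (Metric.closedBall 0 R) = P {ω | ‖b x ω‖ ≤ R} := by
      rw [Measure.map_apply (hb x hx) measurableSet_closedBall]
      congr 1
      ext ω; simp
    have hhalf : (2⁻¹ : ℝ≥0∞) ≤ P {ω | ‖b x ω‖ ≤ R} := by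
      have := ENNReal.ofReal_le_ofReal (hRb x hx)
      rw [ofReal_measureReal] at this
      refine le_trans (le_of_eq ?_) this
      rw [one_div, ENNReal.ofReal_inv_of_pos two_pos]; simp
    calc c * 2⁻¹ ≤ c * P.map (b x) (Metric.closedBall 0 R) := by rw [hball]; gcongr
      _ = ∫⁻ _ in Metric.closedBall 0 R, c ∂P.map (b x) := by rw [setLIntegral_const]
      _ ≤ ∫⁻ u in Metric.closedBall 0 R,
          P.map (a x) (Prod.mk u ⁻¹' {z | s x - γ • (z.2 + z.1) ∈ A}) ∂P.map (b x) := by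
        refine setLIntegral_mono' measurableSet_closedBall fun u hu => ?_
        exact hpart u (by simpa using hu)
      _ ≤ _ := setLIntegral_le_lintegral _ _
  have hc0 : 0 < c * 2⁻¹ := ENNReal.mul_pos hc.ne' (by simp)
  have hmin : 0 < min (c * 2⁻¹) 1 := lt_min hc0 one_pos
  have hmint : min (c * 2⁻¹) 1 ≠ ∞ := ne_top_of_le_ne_top ENNReal.one_ne_top (min_le_right _ _)
  refine ⟨(min (c * 2⁻¹) 1).toReal, ENNReal.toReal_pos hmin.ne' hmint,
    by simpa using ENNReal.toReal_mono ENNReal.one_ne_top (min_le_right (c * 2⁻¹) 1),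
    fun A hA => ?_⟩
  -- Either A or its complement fills at least half of the unit ball; this choice does not depend on
  -- x.
  have hor : volume (Metric.ball (0 : Eucl d) 1) / 2 ≤ volume (A ∩ Metric.ball 0 1) ∨
      volume (Metric.ball (0 : Eucl d) 1) / 2 ≤ volume (Aᶜ ∩ Metric.ball 0 1) := by
    by_contra! h
    have h1 := measure_inter_add_sdiff (μ := (volume : Measure (Eucl d))) (Metric.ball 0 1) hA
    rw [Set.inter_comm, Set.sdiff_eq, Set.inter_comm _ Aᶜ] at h1
    have h2 := ENNReal.add_lt_add h.1 h.2
    rw [h1, ENNReal.add_halves] at h2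
    exact lt_irrefl _ h2
  refine hor.imp (fun h x hx => ?_) (fun h x hx => ?_)
  · exact ENNReal.toReal_mono (measure_ne_top P _) ((min_le_left _ _).trans (key A hA h x hx))
  · exact ENNReal.toReal_mono (measure_ne_top P _)
      ((min_le_left _ _).trans (key Aᶜ hA.compl h x hx))

end Minorization

/-! ### Fourth-moment drift and the invariant law of SGDA -/

section Drift

open Filter Topology

/-- A jointly measurable random field which at each point is centred with second and fourth
moments at most `s₂` and `s₄`. -/
structure CenteredNoise {d : ℕ} {Ω : Type*} [MeasurableSpace Ω] (P : Measure Ω)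
    (N : Eucl d → Ω → Eucl d) (s₂ s₄ : ℝ) : Prop where
  measurable : Measurable (fun p : Eucl d × Ω => N p.1 p.2)
  memLp_four : ∀ x, MemLp (N x) 4 P
  integral_eq_zero : ∀ x, ∫ ω, N x ω ∂P = 0
  second_moment : ∀ x, ∫ ω, ‖N x ω‖ ^ 2 ∂P ≤ s₂
  fourth_moment : ∀ x, ∫ ω, ‖N x ω‖ ^ 4 ∂P ≤ s₄

variable {d : ℕ} {Ω : Type*} [MeasurableSpace Ω] {P : Measure Ω}

/-- Taking expectations of the conditional statements leaves the unconditional moments of U 0, which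
are what the one-step kernel sees. -/
theorem OracleNoise.centeredNoise [IsProbabilityMeasure P] {U : ℕ → Eucl d → Ω → Eucl d} {σ κ G : ℝ}
    (hU : OracleNoise P U σ) (hreg : RegularNoise P U κ G) :
    CenteredNoise P (U 0) (σ ^ 2) (κ ^ 4) := by
  obtain ⟨ℱ, hℱ⟩ := hU.filtration
  have hm : ∀ x, Measurable (U 0 x) := fun x =>
    (hU.measurable 0).comp (measurable_const.prodMk measurable_id)
  refine ⟨hU.measurable 0, fun x => ?_, fun x => ?_, fun x => ?_,
    fun x => (hreg.fourth_moment 0 x).le⟩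
  · rw [← integrable_norm_rpow_iff (hm x).aestronglyMeasurable (by norm_num) (by norm_num)]
    refine (hreg.integrable_four 0 x).congr (Eventually.of_forall fun ω => ?_)
    have : ((4 : ℝ≥0∞).toReal) = ((4 : ℕ) : ℝ) := by norm_num
    rw [this]
    exact (Real.rpow_natCast _ 4).symm
  · rw [← integral_condExp (ℱ.le 0), integral_congr_ae (hℱ 0 x).2.1]; simp
  · rw [← integral_condExp (ℱ.le 0)]
    refine (integral_mono_ae integrable_condExp (integrable_const _) (hℱ 0 x).2.2).trans ?_
    simp

namespace CenteredNoise

variable {N : Eucl d → Ω → Eucl d} {s₂ s₄ : ℝ}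

theorem measurable_apply (hN : CenteredNoise P N s₂ s₄) (x : Eucl d) : Measurable (N x) :=
  hN.measurable.comp (measurable_const.prodMk measurable_id)

theorem integrable [IsProbabilityMeasure P] (hN : CenteredNoise P N s₂ s₄) (x : Eucl d) :
    Integrable (N x) P :=
  (hN.memLp_four x).integrable (by norm_num)

theorem integrable_sq [IsProbabilityMeasure P] (hN : CenteredNoise P N s₂ s₄) (x : Eucl d) :
    Integrable (fun ω => ‖N x ω‖ ^ 2) P :=
  ((hN.memLp_four x).mono_exponent (by norm_num)).integrable_norm_pow (by norm_num)

theorem integrable_four (hN : CenteredNoise P N s₂ s₄) (x : Eucl d) :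
    Integrable (fun ω => ‖N x ω‖ ^ 4) P :=
  (hN.memLp_four x).integrable_norm_pow (by norm_num)

theorem fourth_nonneg (hN : CenteredNoise P N s₂ s₄) : 0 ≤ s₄ :=
  (integral_nonneg fun _ => by positivity).trans (hN.fourth_moment 0)

end CenteredNoise

/-- The square of the expansion of ‖a - γu‖². The inner product is kept only in the term linear in
u, which vanishes for centred noise; elsewhere Cauchy–Schwarz and Young's inequality absorb it. -/
theorem norm_sub_smul_pow_four_le {E : Type*} [NormedAddCommGroup E] [InnerProductSpace ℝ E]
    (a u : E) (γ : ℝ) :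
    ‖a - γ • u‖ ^ 4 ≤ ‖a‖ ^ 4 + 8 * γ ^ 2 * ‖a‖ ^ 2 * ‖u‖ ^ 2 + 3 * γ ^ 4 * ‖u‖ ^ 4
      - 4 * γ * ‖a‖ ^ 2 * inner ℝ a u := by
  have h1 : ‖a - γ • u‖ ^ 2 = ‖a‖ ^ 2 - 2 * γ * inner ℝ a u + γ ^ 2 * ‖u‖ ^ 2 := by
    rw [norm_sub_sq_real, inner_smul_right, norm_smul, mul_pow, Real.norm_eq_abs, sq_abs]; ring
  have h2 : ‖a - γ • u‖ ^ 4 = (‖a - γ • u‖ ^ 2) ^ 2 := by ring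
  have h3 : (inner ℝ a u) ^ 2 ≤ ‖a‖ ^ 2 * ‖u‖ ^ 2 := by
    rw [← mul_pow, ← sq_abs]
    exact pow_le_pow_left₀ (abs_nonneg _) (abs_real_inner_le_norm a u) 2
  rw [h2, h1]
  have h4 := mul_le_mul_of_nonneg_left h3 (sq_nonneg γ)
  nlinarith [sq_nonneg (γ * inner ℝ a u + γ ^ 2 * ‖u‖ ^ 2)]

theorem CenteredNoise.integral_norm_sub_smul_pow_four_le [IsProbabilityMeasure P]
    {N : Eucl d → Ω → Eucl d} {s₂ s₄ : ℝ}
    (hN : CenteredNoise P N s₂ s₄) (x a : Eucl d) (γ : ℝ) :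
    Integrable (fun ω => ‖a - γ • N x ω‖ ^ 4) P ∧ ∫ ω, ‖a - γ • N x ω‖ ^ 4 ∂P ≤
      ‖a‖ ^ 4 + 8 * γ ^ 2 * s₂ * ‖a‖ ^ 2 + 3 * γ ^ 4 * s₄ := by
  have hi : Integrable (fun ω => ‖a - γ • N x ω‖ ^ 4) P :=
    ((memLp_const a).sub ((hN.memLp_four x).const_smul γ)).integrable_norm_pow (by norm_num)
  refine ⟨hi, ?_⟩
  have i1 : Integrable (fun ω => 8 * γ ^ 2 * ‖a‖ ^ 2 * ‖N x ω‖ ^ 2) P :=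
    (hN.integrable_sq x).const_mul _
  have i2 : Integrable (fun ω => 3 * γ ^ 4 * ‖N x ω‖ ^ 4) P := (hN.integrable_four x).const_mul _
  have i3 : Integrable (fun ω => 4 * γ * ‖a‖ ^ 2 * inner ℝ a (N x ω)) P :=
    ((hN.integrable x).const_inner a).const_mul _
  have i01 : Integrable (fun ω => ‖a‖ ^ 4 + 8 * γ ^ 2 * ‖a‖ ^ 2 * ‖N x ω‖ ^ 2) P :=
    (integrable_const _).add i1
  have i012 : Integrable (fun ω => ‖a‖ ^ 4 + 8 * γ ^ 2 * ‖a‖ ^ 2 * ‖N x ω‖ ^ 2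
      + 3 * γ ^ 4 * ‖N x ω‖ ^ 4) P := i01.add i2
  refine (integral_mono hi (i012.sub i3) fun ω => norm_sub_smul_pow_four_le a (N x ω) γ).trans ?_
  have e : ∫ ω, inner ℝ a (N x ω) ∂P = 0 := by
    rw [integral_inner (hN.integrable x), hN.integral_eq_zero]; simp
  simp only [Pi.sub_apply]
  rw [integral_sub i012 i3, integral_add i01 i2, integral_add (integrable_const _) i1,
    integral_const_mul, integral_const_mul, integral_const_mul, e]
  simp only [integral_const, probReal_univ, one_smul, mul_zero, sub_zero]
  have h1 := hN.second_moment x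
  have h2 := hN.fourth_moment x
  calc _ ≤ ‖a‖ ^ 4 + 8 * γ ^ 2 * ‖a‖ ^ 2 * s₂ + 3 * γ ^ 4 * s₄ := by gcongr
    _ = _ := by ring

theorem sgdaKernel_eq_map [IsProbabilityMeasure P]
    {F : Eucl d → Eucl d} (hF : Measurable F) {N : Eucl d → Ω → Eucl d}
    (hN : Measurable (fun p : Eucl d × Ω => N p.1 p.2)) (γ : ℝ) (x : Eucl d) :
    sgdaKernel P F N γ x = P.map (fun ω => x - γ • (F x + N x ω)) := by
  refine Measure.ext fun B hB => ?_
  have hNx : Measurable (N x) := hN.comp (measurable_const.prodMk measurable_id)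
  rw [sgdaKernel_apply P F hF N hN γ x B hB, Measure.map_apply (by fun_prop) hB]
  rfl

theorem isMarkovKernel_sgdaKernel [IsProbabilityMeasure P] {F : Eucl d → Eucl d} (hF : Measurable F)
    {N : Eucl d → Ω → Eucl d} (hN : Measurable (fun p : Eucl d × Ω => N p.1 p.2)) (γ : ℝ) :
    IsMarkovKernel (sgdaKernel P F N γ) := by
  refine ⟨fun x => ?_⟩
  have hNx : Measurable (N x) := hN.comp (measurable_const.prodMk measurable_id)
  rw [sgdaKernel_eq_map hF hN]
  exact Measure.isProbabilityMeasure_map (by fun_prop)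

/-- Stationarity as an identity of laws for a state and a fresh independent noise, the form in which
moments are computed by Fubini. -/
theorem map_prod_of_invariant [IsProbabilityMeasure P]
    {F : Eucl d → Eucl d} (hF : Measurable F) {N : Eucl d → Ω → Eucl d}
    (hN : Measurable (fun p : Eucl d × Ω => N p.1 p.2)) {γ : ℝ} {π : Measure (Eucl d)}
    (hπ : Kernel.Invariant (sgdaKernel P F N γ) π) :
    (π.prod P).map (fun p => p.1 - γ • (F p.1 + N p.1 p.2)) = π := by
  have hm : Measurable (fun p : Eucl d × Ω => p.1 - γ • (F p.1 + N p.1 p.2)) := by fun_prop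
  conv_rhs => rw [← hπ.def]
  refine Measure.ext fun B hB => ?_
  rw [Measure.map_apply hm hB, Measure.prod_apply (hm hB),
    Measure.bind_apply hB (Kernel.aemeasurable _)]
  refine lintegral_congr fun x => ?_
  rw [sgdaKernel_apply P F hF N hN γ x B hB]
  rfl

/-- The drift of the noiseless step. -/
theorem norm_sub_smul_sq_le {F : Eucl d → Eucl d} {xs : Eucl d} {m γ : ℝ} {L : ℝ≥0}
    (hxs : F xs = 0) (hmono : WeakQuasiStronglyMonotone F xs m 0) (hF : LipschitzWith L F)
    (hγ : 0 < γ) (hγL : γ * L ^ 2 ≤ m) (x : Eucl d) :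
    ‖(x - xs) - γ • F x‖ ^ 2 ≤ (1 - γ * m) * ‖x - xs‖ ^ 2 := by
  have h1 : ‖F x‖ ≤ L * ‖x - xs‖ := by simpa [hxs] using hF.norm_sub_le x xs
  have h2 : ‖F x‖ ^ 2 ≤ L ^ 2 * ‖x - xs‖ ^ 2 := by
    rw [← mul_pow]; exact pow_le_pow_left₀ (norm_nonneg _) h1 2
  have h3 := hmono x
  rw [norm_sub_sq_real, inner_smul_right, norm_smul, mul_pow, Real.norm_eq_abs, sq_abs,
    real_inner_comm]
  -- Since γL² ≤ m, the quadratic term takes back at most half of the gain 2γm from monotonicity.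
  have h4 : γ ^ 2 * ‖F x‖ ^ 2 ≤ γ * m * ‖x - xs‖ ^ 2 := by
    calc γ ^ 2 * ‖F x‖ ^ 2 ≤ γ ^ 2 * (L ^ 2 * ‖x - xs‖ ^ 2) := by gcongr
      _ = γ * (γ * L ^ 2) * ‖x - xs‖ ^ 2 := by ring
      _ ≤ γ * m * ‖x - xs‖ ^ 2 := by gcongr
  nlinarith

/-- For small step sizes, SGDA has exactly one invariant probability measure; its fourth centred
moment is of the order of the square of the step size. -/
theorem exists_unique_invariant_sgdaKernel [IsProbabilityMeasure P]
    {F : Eucl d → Eucl d} {xs : Eucl d} {m γ s₄ σ : ℝ}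
    {L : ℝ≥0} (hxs : F xs = 0) (hm : 0 < m) (hmono : WeakQuasiStronglyMonotone F xs m 0)
    (hF : LipschitzWith L F) {U : ℕ → Eucl d → Ω → Eucl d}
    (hN : CenteredNoise P (U 0) (σ ^ 2) s₄) (hdens : PositiveDensityComponent P U)
    (hγ : 0 < γ) (hγ1 : γ ≤ 1) (hγm : γ * m ≤ 1) (hγL : γ * L ^ 2 ≤ m) :
    ∃ π : Measure (Eucl d), IsProbabilityMeasure π ∧
      Kernel.Invariant (sgdaKernel P F (U 0) γ) π ∧
      Integrable (fun x => ‖x - xs‖ ^ 4) π ∧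
      ∫ x, ‖x - xs‖ ^ 4 ∂π ≤ 2 * (32 * (σ ^ 2) ^ 2 / m + 3 * s₄) / m * γ ^ 2 ∧
      ∀ ν : Measure (Eucl d), IsProbabilityMeasure ν →
        Kernel.Invariant (sgdaKernel P F (U 0) γ) ν → ν = π := by
  have hFm : Measurable F := hF.continuous.measurable
  have hNm := hN.measurable
  have := isMarkovKernel_sgdaKernel (P := P) hFm hNm γ
  have h4 := hN.fourth_nonneg
  set B : ℝ := 32 * (σ ^ 2) ^ 2 / m + 3 * s₄ with hB
  have hB0 : 0 ≤ B := by positivity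
  set lam : ℝ := 1 - γ * m / 2 with hlam
  -- The first term is what `b_le` requires; the added 1 makes R positive.
  set R : ℝ := 4 * (γ ^ 3 * B) / (1 - lam) + 1 with hR
  have hl : 1 - lam = γ * m / 2 := by rw [hlam]; ring
  have hl0 : 0 < 1 - lam := by rw [hl]; positivity
  set s : Eucl d → Eucl d := fun x => x - γ • F x with hs
  have hstep : ∀ x ω, x - γ • (F x + U 0 x ω) = s x - γ • U 0 x ω := fun x ω => by
    simp only [hs, smul_add]; abel
  obtain ⟨Ua, Ub, p, hp⟩ := hdens
  obtain ⟨hp1, hp2⟩ := hp 0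
  have hVc : ∀ x : Eucl d, ‖x - xs‖ ^ 4 ≤ R → ‖x - xs‖ ≤ R + 1 := by
    intro x hx
    by_contra! h
    have hR0 : 1 ≤ R := by rw [hR]; have : 0 ≤ 4 * (γ ^ 3 * B) / (1 - lam) := by positivity
                           linarith
    have : ‖x - xs‖ ≤ ‖x - xs‖ ^ 4 := le_self_pow₀ (by linarith) (by norm_num)
    linarith
  have hbdd : Bornology.IsBounded {x : Eucl d | ‖x - xs‖ ^ 4 ≤ R} := by
    refine (Metric.isBounded_closedBall (x := xs) (r := R + 1)).subset fun x hx => ?_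
    rw [Metric.mem_closedBall, dist_eq_norm]; exact hVc x hx
  obtain ⟨α, hα, hα1, hdich⟩ := exists_uniform_charge (P := P)
    (C := {x : Eucl d | ‖x - xs‖ ^ 4 ≤ R}) (a := Ua 0) (b := Ub 0) (U := U 0) (p := p 0)
    (fun x _ => (hp1 x).1) (fun x _ => (hp1 x).2.1) (fun x _ => (hp1 x).2.2.1)
    (fun x _ => (hp1 x).2.2.2.1) (fun x _ => (hp1 x).2.2.2.2.1) (fun x _ => (hp1 x).2.2.2.2.2)
    (hp2 _ hbdd) (σ := σ) (fun x _ => hN.integrable_sq x) (fun x _ => hN.second_moment x)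
    (s := s) (M := ‖xs‖ + (R + 1)) (fun x hx => by
      have h1 := norm_sub_smul_sq_le hxs hmono hF hγ hγL x
      have h2 : ‖(x - xs) - γ • F x‖ ≤ ‖x - xs‖ := by
        refine le_of_sq_le_sq ?_ (norm_nonneg _)
        have : 0 ≤ γ * m * ‖x - xs‖ ^ 2 := by positivity
        linarith
      have h3 : s x = xs + ((x - xs) - γ • F x) := by rw [hs]; abel_nf
      rw [h3]
      exact (norm_add_le _ _).trans (by gcongr; exact h2.trans (hVc x hx))) hγ
  have hreal : ∀ x A, MeasurableSet A → (sgdaKernel P F (U 0) γ x).real A =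
      P.real {ω | s x - γ • U 0 x ω ∈ A} := fun x A hA => by
    rw [measureReal_def, sgdaKernel_apply P F hFm _ hNm γ x A hA, measureReal_def]
    simp_rw [hstep]
  have hmstep : ∀ x, Measurable (fun ω => x - γ • (F x + U 0 x ω)) := fun x => by
    have := hN.measurable_apply x
    fun_prop
  have hsplit : ∀ x ω, ‖x - γ • (F x + U 0 x ω) - xs‖ ^ 4 =
      ‖((x - xs) - γ • F x) - γ • U 0 x ω‖ ^ 4 := fun x ω => by
    congr 2; rw [smul_add]; abel
  have hVm : Measurable (fun x : Eucl d => ‖x - xs‖ ^ 4) := by fun_prop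
  have H : HarrisCondition (sgdaKernel P F (U 0) γ) (fun x => ‖x - xs‖ ^ 4) lam (γ ^ 3 * B) R α :=
    { measurable := hVm
      nonneg := fun x => by positivity
      integrable := fun x => by
        rw [sgdaKernel_eq_map hFm hNm,
          integrable_map_measure hVm.aestronglyMeasurable (hmstep x).aemeasurable]
        simp only [Function.comp_def, hsplit]
        exact (hN.integral_norm_sub_smul_pow_four_le x _ γ).1
      drift := fun x => by
        rw [sgdaKernel_eq_map hFm hNm,
          integral_map (hmstep x).aemeasurable hVm.aestronglyMeasurable]
        simp only [hsplit]
        refine (hN.integral_norm_sub_smul_pow_four_le x _ γ).2.trans ?_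
        have h1 := norm_sub_smul_sq_le hxs hmono hF hγ hγL x
        set A := ‖(x - xs) - γ • F x‖ ^ 2
        have e1 : ‖(x - xs) - γ • F x‖ ^ 4 = A ^ 2 := by simp only [A]; ring
        have hA0 : 0 ≤ A := by positivity
        set Z := ‖x - xs‖ ^ 2
        have e2 : ‖x - xs‖ ^ 4 = Z ^ 2 := by simp only [Z]; ring
        have hZ0 : 0 ≤ Z := by positivity
        rw [e1, e2]
        have h2 : A ≤ Z := by
          have : 0 ≤ γ * m * Z := by positivity
          linarith
        have h3 : A ^ 2 ≤ (1 - γ * m) * Z ^ 2 := by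
          calc A ^ 2 = A * A := sq A
            _ ≤ ((1 - γ * m) * Z) * Z := by gcongr
            _ = _ := by ring
        -- Young's inequality spends half of the contraction γm on the cross term and leaves an
        -- error of order γ³, hence lam = 1 - γm/2.
        have h5 : 8 * γ ^ 2 * σ ^ 2 * A ≤ γ * m / 2 * Z ^ 2 + 32 * γ ^ 3 * (σ ^ 2) ^ 2 / m := by
          have e : γ * m / 2 * Z ^ 2 + 32 * γ ^ 3 * (σ ^ 2) ^ 2 / m - 8 * γ ^ 2 * σ ^ 2 * Z =
              γ / (2 * m) * (m * Z - 8 * γ * σ ^ 2) ^ 2 := by field_simp; ring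
          have h6 : 0 ≤ γ / (2 * m) * (m * Z - 8 * γ * σ ^ 2) ^ 2 := by positivity
          have h7 : 8 * γ ^ 2 * σ ^ 2 * A ≤ 8 * γ ^ 2 * σ ^ 2 * Z := by gcongr
          linarith
        have h8 : 3 * γ ^ 4 * s₄ ≤ 3 * γ ^ 3 * s₄ := by
          have : γ ^ 4 ≤ γ ^ 3 := pow_le_pow_of_le_one hγ.le hγ1 (by norm_num)
          gcongr
        have e3 : γ ^ 3 * B = 32 * γ ^ 3 * (σ ^ 2) ^ 2 / m + 3 * γ ^ 3 * s₄ := by rw [hB]; ring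
        rw [e3, hlam]
        linarith
      lam_nonneg := by rw [hlam]; linarith
      lam_lt_one := by linarith
      b_nonneg := by positivity
      R_pos := by positivity
      b_le := by
        have : (1 - lam) * R = 4 * (γ ^ 3 * B) + (1 - lam) := by
          simp only [R]; generalize γ ^ 3 * B = y; field_simp
        linarith
      α_pos := hα
      α_le_one := hα1
      dichotomy := fun A hA => (hdich A hA).imp
        (fun h x hx => by rw [hreal x A hA]; exact h x hx)
        (fun h x hx => by rw [hreal x _ hA.compl]; exact h x hx) }
  obtain ⟨π, hπ, hinv, hint, hle, huniq⟩ := H.exists_unique_invariant (x₀ := xs) (by simp)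
  refine ⟨π, hπ, hinv, hint, hle.trans (le_of_eq ?_), huniq⟩
  rw [hl]
  field_simp

end Drift

/-! ### Taylor expansions in coordinates and coercivity of the linearization -/

section Taylor

open Set
open scoped Nat

variable {E H : Type*} [NormedAddCommGroup E] [NormedSpace ℝ E] [NormedAddCommGroup H]
  [NormedSpace ℝ H]

theorem iteratedDeriv_comp_add_smul {n : ℕ} {f : E → H} (hf : ContDiff ℝ n f) (x z : E) {k : ℕ}
    (hk : k ≤ n) : iteratedDeriv k (fun t : ℝ => f (x + t • z)) =
      fun t => iteratedFDeriv ℝ k f (x + t • z) fun _ => z := by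
  induction k with
  | zero => funext t; simp
  | succ k ih =>
    rw [iteratedDeriv_succ, ih (Nat.le_of_succ_le hk)]
    funext t
    have h1 : HasFDerivAt (iteratedFDeriv ℝ k f) (fderiv ℝ (iteratedFDeriv ℝ k f) (x + t • z))
        (x + t • z) :=
      (hf.differentiable_iteratedFDeriv (by exact_mod_cast hk) _).hasFDerivAt
    have h2 : HasDerivAt (fun t : ℝ => x + t • z) z t := by
      simpa using ((hasDerivAt_id t).smul_const z).const_add x
    have h3 := h1.comp_hasDerivAt t h2
    have h4 := ((ContinuousMultilinearMap.apply ℝ (fun _ : Fin k => E) H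
      (fun _ => z)).hasFDerivAt).comp_hasDerivAt t h3
    rw [iteratedFDeriv_succ_apply_left]
    exact h4.deriv

/-- Taylor's formula with a global bound on the remainder. -/
theorem norm_sub_taylor_le {n : ℕ} {f : E → H} (hf : ContDiff ℝ (n + 1 : ℕ) f) {K : ℝ}
    (hK : ∀ x, ‖iteratedFDeriv ℝ (n + 1) f x‖ ≤ K) (x z : E) :
    ‖f (x + z) - ∑ k ∈ Finset.range (n + 1), ((k ! : ℝ)⁻¹) • iteratedFDeriv ℝ k f x fun _ => z‖ ≤
      K * ‖z‖ ^ (n + 1) := by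
  have hφ : ContDiff ℝ (n + 1 : ℕ) (fun t : ℝ => f (x + t • z)) := by fun_prop
  have hw : ∀ k ≤ n + 1, ∀ t ∈ Icc (0 : ℝ) 1,
      iteratedDerivWithin k (fun t : ℝ => f (x + t • z)) (Icc 0 1) t =
        iteratedFDeriv ℝ k f (x + t • z) fun _ => z := by
    intro k hk t ht
    rw [iteratedDerivWithin_eq_iteratedDeriv (uniqueDiffOn_Icc one_pos)
      (hφ.of_le (by exact_mod_cast hk)).contDiffAt ht, iteratedDeriv_comp_add_smul hf x z hk]
  have h := taylor_mean_remainder_bound (f := fun t : ℝ => f (x + t • z)) (n := n)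
    (C := K * ‖z‖ ^ (n + 1)) zero_le_one hφ.contDiffOn (right_mem_Icc.2 zero_le_one) (by
      intro t ht
      rw [hw _ le_rfl t ht]
      refine (ContinuousMultilinearMap.le_opNorm _ _).trans ?_
      simp only [Finset.prod_const, Finset.card_univ, Fintype.card_fin]
      exact mul_le_mul_of_nonneg_right (hK _) (by positivity))
  rw [taylor_within_apply] at h
  have e : ∑ k ∈ Finset.range (n + 1), ((k ! : ℝ)⁻¹ * (1 - 0) ^ k) •
      iteratedDerivWithin k (fun t : ℝ => f (x + t • z)) (Icc 0 1) 0 =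
      ∑ k ∈ Finset.range (n + 1), ((k ! : ℝ)⁻¹) • iteratedFDeriv ℝ k f x fun _ => z := by
    refine Finset.sum_congr rfl fun k hk => ?_
    rw [hw k (Finset.mem_range.1 hk).le 0 (left_mem_Icc.2 zero_le_one)]
    simp
  rw [e] at h
  simp only [one_smul, sub_zero, one_pow, mul_one] at h
  refine h.trans (div_le_self ?_ (by exact_mod_cast Nat.one_le_iff_ne_zero.2 n.factorial_ne_zero))
  have := (norm_nonneg _).trans (hK x)
  positivity

theorem Fin.sum_pi_succ {M ι : Type*} [AddCommMonoid M] [Fintype ι] {n : ℕ}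
    (f : (Fin (n + 1) → ι) → M) : ∑ r, f r = ∑ j, ∑ r : Fin n → ι, f (Fin.cons j r) := by
  rw [← Fintype.sum_prod_type', ← (Fin.consEquiv fun _ : Fin (n + 1) => ι).sum_comp]
  rfl

/-- Multilinearity in the standard basis: derivatives become arrays of numbers paired with monomials
in z, which can be integrated one by one. -/
theorem ContinuousMultilinearMap.apply_diag_eq_sum {d n : ℕ}
    (T : ContinuousMultilinearMap ℝ (fun _ : Fin n => Eucl d) H) (z : Eucl d) :
    (T fun _ => z) = ∑ r : Fin n → Fin d,
      (∏ l, z (r l)) • T fun l => EuclideanSpace.single (r l) (1 : ℝ) := by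
  have hz : z = ∑ j, z j • EuclideanSpace.single j (1 : ℝ) := by
    have := (EuclideanSpace.basisFun (Fin d) ℝ).sum_repr z
    simpa using this.symm
  conv_lhs => rw [hz]
  rw [← ContinuousMultilinearMap.coe_coe, MultilinearMap.map_sum]
  refine Finset.sum_congr rfl fun r _ => ?_
  rw [MultilinearMap.map_smul_univ]

/-- The coefficients of the third order Taylor expansion of an operator at a zero. -/
theorem SmoothOperator.exists_taylor {d : ℕ} {F : Eucl d → Eucl d} {L : ℝ≥0}
    (hF : SmoothOperator F L) {xs : Eucl d} (hxs : F xs = 0) :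
    ∃ (A : Fin d → Fin d → ℝ) (B : Fin d → Fin d → Fin d → ℝ)
      (D : Fin d → Fin d → Fin d → Fin d → ℝ) (K : ℝ), 0 ≤ K ∧ ∀ x i,
      |F x i - ∑ j, A i j * (x - xs) j| ≤ K * ‖x - xs‖ ^ 2 ∧
      |F x i - (∑ j, A i j * (x - xs) j + ∑ j, ∑ k, B i j k * ((x - xs) j * (x - xs) k))| ≤
        K * ‖x - xs‖ ^ 3 ∧
      |F x i - (∑ j, A i j * (x - xs) j + ∑ j, ∑ k, B i j k * ((x - xs) j * (x - xs) k) +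
        ∑ j, ∑ k, ∑ l, D i j k l * ((x - xs) j * (x - xs) k * (x - xs) l))| ≤
        K * ‖x - xs‖ ^ 4 := by
  obtain ⟨K2, hK2⟩ := hF.bounded 2 (by simp)
  obtain ⟨K3, hK3⟩ := hF.bounded 3 (by simp)
  obtain ⟨K4, hK4⟩ := hF.bounded 4 (by simp)
  have h2 := norm_sub_taylor_le (n := 1) (hF.contDiff.of_le (by norm_num)) hK2 xs
  have h3 := norm_sub_taylor_le (n := 2) (hF.contDiff.of_le (by norm_num)) hK3 xs
  have h4 := norm_sub_taylor_le (n := 3) (hF.contDiff.of_le (by norm_num)) hK4 xs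
  set e : Fin d → Eucl d := fun j => EuclideanSpace.single j (1 : ℝ) with he
  refine ⟨fun i j => iteratedFDeriv ℝ 1 F xs (fun l => e ((Fin.cons j ![] : Fin 1 → Fin d) l)) i,
    fun i j k => 2⁻¹ *
      iteratedFDeriv ℝ 2 F xs (fun l => e ((Fin.cons j (Fin.cons k ![]) : Fin 2 → Fin d) l)) i,
    fun i j k l => 6⁻¹ * iteratedFDeriv ℝ 3 F xs
      (fun o => e ((Fin.cons j (Fin.cons k (Fin.cons l ![])) : Fin 3 → Fin d) o)) i,
    |K2| + |K3| + |K4|, by positivity, fun x i => ?_⟩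
  have b2 : K2 ≤ |K2| + |K3| + |K4| := by
    linarith [le_abs_self K2, abs_nonneg K3, abs_nonneg K4]
  have b3 : K3 ≤ |K2| + |K3| + |K4| := by
    linarith [le_abs_self K3, abs_nonneg K2, abs_nonneg K4]
  have b4 : K4 ≤ |K2| + |K3| + |K4| := by
    linarith [le_abs_self K4, abs_nonneg K3, abs_nonneg K2]
  have hc : ∀ v : Eucl d, |v i| ≤ ‖v‖ := fun v => PiLp.norm_apply_le v i
  set z := x - xs with hz
  have hxz : xs + z = x := by rw [hz]; abel
  specialize h2 z
  specialize h3 z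
  specialize h4 z
  rw [hxz] at h2 h3 h4
  have g1 : (iteratedFDeriv ℝ 1 F xs fun _ => z) i =
      ∑ j, iteratedFDeriv ℝ 1 F xs (fun l => e ((Fin.cons j ![] : Fin 1 → Fin d) l)) i * z j := by
    rw [ContinuousMultilinearMap.apply_diag_eq_sum, Fin.sum_pi_succ]
    simp [mul_comm, he, Subsingleton.elim _ (![] : Fin 0 → Fin d)]
  have g2 : (iteratedFDeriv ℝ 2 F xs fun _ => z) i = ∑ j, ∑ k, iteratedFDeriv ℝ 2 F xs
      (fun l => e ((Fin.cons j (Fin.cons k ![]) : Fin 2 → Fin d) l)) i * (z j * z k) := by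
    rw [ContinuousMultilinearMap.apply_diag_eq_sum]
    simp only [Fin.sum_pi_succ]
    simp [Fin.prod_univ_succ, mul_comm, he, Subsingleton.elim _ (![] : Fin 0 → Fin d)]
  have g3 : (iteratedFDeriv ℝ 3 F xs fun _ => z) i = ∑ j, ∑ k, ∑ l, iteratedFDeriv ℝ 3 F xs
      (fun o => e ((Fin.cons j (Fin.cons k (Fin.cons l ![])) : Fin 3 → Fin d) o)) i *
        (z j * z k * z l) := by
    rw [ContinuousMultilinearMap.apply_diag_eq_sum]
    simp only [Fin.sum_pi_succ]
    simp [Fin.prod_univ_succ, mul_comm, mul_assoc, he,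
      Subsingleton.elim _ (![] : Fin 0 → Fin d)]
  have hsum2 : ∀ c : ℝ, ∀ a : Fin d → Fin d → ℝ, ∑ j, ∑ k, c * a j k * (z j * z k) =
      c * ∑ j, ∑ k, a j k * (z j * z k) := fun c a => by
    simp only [Finset.mul_sum, mul_assoc]
  have hsum3 : ∀ c : ℝ, ∀ a : Fin d → Fin d → Fin d → ℝ,
      ∑ j, ∑ k, ∑ l, c * a j k l * (z j * z k * z l) =
      c * ∑ j, ∑ k, ∑ l, a j k l * (z j * z k * z l) := fun c a => by
    simp only [Finset.mul_sum, mul_assoc]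
  rw [hsum2 2⁻¹, hsum3 6⁻¹, ← g1, ← g2, ← g3]
  have t2 := (hc _).trans h2
  have t3 := (hc _).trans h3
  have t4 := (hc _).trans h4
  simp only [Finset.sum_range_succ, Finset.sum_range_zero, iteratedFDeriv_zero_apply, hxs,
    smul_zero, zero_add, PiLp.sub_apply, PiLp.add_apply, PiLp.smul_apply, smul_eq_mul,
    Nat.factorial] at t2 t3 t4
  norm_num at t2 t3 t4
  refine ⟨?_, ?_, ?_⟩
  · refine le_trans ?_ (t2.trans (by gcongr))
    simp
  · refine le_trans ?_ (t3.trans (by gcongr))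
    norm_num
  · refine le_trans ?_ (t4.trans (by gcongr))
    norm_num

/-- The coefficients of the first order Taylor expansion of a covariance tensor. -/
theorem RegularNoise.exists_taylor {d : ℕ} {Ω : Type*} [MeasurableSpace Ω] {P : Measure Ω}
    {U : ℕ → Eucl d → Ω → Eucl d} {κ G : ℝ} (hreg : RegularNoise P U κ G) (xs : Eucl d) :
    ∃ (C : Fin d → Fin d → ℝ) (C' : Fin d → Fin d → Fin d → ℝ) (K : ℝ), 0 ≤ K ∧ ∀ x i j,
      |covTensor P (U 0) x i j - C i j| ≤ K * ‖x - xs‖ ∧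
      |covTensor P (U 0) x i j - (C i j + ∑ k, C' i j k * (x - xs) k)| ≤ K * ‖x - xs‖ ^ 2 := by
  have hc := hreg.cov_contDiff 0
  -- Order n = 0 is the mean value inequality; only the bounds on the first two derivatives of the
  -- covariance enter.
  have h1 := norm_sub_taylor_le (n := 0) (hc.of_le (by norm_num))
    (fun x => (hreg.cov_bounded 0 1 (by simp) x).le) xs
  have h2 := norm_sub_taylor_le (n := 1) (hc.of_le (by norm_num))
    (fun x => (hreg.cov_bounded 0 2 (by simp) x).le) xs
  set e : Fin d → Eucl d := fun j => EuclideanSpace.single j (1 : ℝ) with he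
  refine ⟨covTensor P (U 0) xs, fun i j k => iteratedFDeriv ℝ 1 (covTensor P (U 0)) xs
    (fun l => e ((Fin.cons k ![] : Fin 1 → Fin d) l)) i j, |G|, abs_nonneg G, fun x i j => ?_⟩
  have hn : ∀ T : Fin d → Fin d → ℝ, |T i j| ≤ ‖T‖ := fun T =>
    (norm_le_pi_norm (T i) j).trans (norm_le_pi_norm T i)
  set z := x - xs with hz
  have hxz : xs + z = x := by rw [hz]; abel
  specialize h1 z
  specialize h2 z
  rw [hxz] at h1 h2
  have g1 : (iteratedFDeriv ℝ 1 (covTensor P (U 0)) xs fun _ => z) i j =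
      ∑ k, iteratedFDeriv ℝ 1 (covTensor P (U 0)) xs
        (fun l => e ((Fin.cons k ![] : Fin 1 → Fin d) l)) i j * z k := by
    rw [ContinuousMultilinearMap.apply_diag_eq_sum, Fin.sum_pi_succ]
    simp [mul_comm, he, Subsingleton.elim _ (![] : Fin 0 → Fin d), Finset.sum_apply]
  rw [← g1]
  have t1 := (hn _).trans h1
  have t2 := (hn _).trans h2
  simp only [Finset.sum_range_succ, Finset.sum_range_zero, iteratedFDeriv_zero_apply, zero_add,
    Pi.sub_apply, Pi.add_apply, Pi.smul_apply, smul_eq_mul, Nat.factorial] at t1 t2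
  norm_num [-iteratedFDeriv_one_apply] at t1 t2
  have := le_abs_self G
  exact ⟨t1.trans (by gcongr), t2.trans (by gcongr)⟩

/-- The linearization of a quasi-strongly monotone operator at its zero is coercive. -/
theorem WeakQuasiStronglyMonotone.coercive {d : ℕ} {F : Eucl d → Eucl d} {xs : Eucl d} {m K : ℝ}
    (hmono : WeakQuasiStronglyMonotone F xs m 0) {A : Fin d → Fin d → ℝ} (hK : 0 ≤ K)
    (hA : ∀ x i, |F x i - ∑ j, A i j * (x - xs) j| ≤ K * ‖x - xs‖ ^ 2) (v : Fin d → ℝ) :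
    m * ∑ i, v i ^ 2 ≤ ∑ i, (∑ j, A i j * v j) * v i := by
  set V : Eucl d := WithLp.toLp 2 v with hV
  have hVn : ‖V‖ ^ 2 = ∑ i, v i ^ 2 := by rw [EuclideanSpace.real_norm_sq_eq]
  set W : ℝ := ∑ i, K * ‖V‖ ^ 2 * |v i| with hW
  have hW0 : 0 ≤ W := Finset.sum_nonneg fun i _ => by positivity
  refine le_of_forall_pos_le_add fun ε hε => ?_
  -- Monotonicity is tested at xs + tV. After division by t² the Taylor error is tW, which this t
  -- keeps below ε.
  set t : ℝ := ε / (W + 1) with ht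
  have ht0 : 0 < t := by positivity
  have htW : t * W ≤ ε := by
    rw [ht, div_mul_eq_mul_div, div_le_iff₀ (by positivity)]; nlinarith
  have h1 := hmono (xs + t • V)
  have e1 : xs + t • V - xs = t • V := by abel
  rw [e1, sub_zero, norm_smul, mul_pow, Real.norm_eq_abs, sq_abs, inner_smul_right, hVn,
    PiLp.inner_apply] at h1
  have h2 : ∑ i, inner ℝ (F (xs + t • V) i) (V i) ≤
      t * ∑ i, (∑ j, A i j * v j) * v i + t ^ 2 * W := by
    rw [hW, Finset.mul_sum, Finset.mul_sum, ← Finset.sum_add_distrib]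
    refine Finset.sum_le_sum fun i _ => ?_
    have h3 := hA (xs + t • V) i
    rw [e1, norm_smul, mul_pow, Real.norm_eq_abs, sq_abs] at h3
    have h4 : ∑ j, A i j * (t • V) j = t * ∑ j, A i j * v j := by
      rw [Finset.mul_sum]
      exact Finset.sum_congr rfl fun j _ => by simp [hV]; ring
    rw [h4] at h3
    have h5 : inner ℝ (F (xs + t • V) i) (V i) = F (xs + t • V) i * v i := by
      simp [hV, mul_comm]
    have h6 : (F (xs + t • V) i - t * ∑ j, A i j * v j) * v i ≤ K * (t ^ 2 * ‖V‖ ^ 2) * |v i| := by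
      refine (le_abs_self _).trans ?_
      rw [abs_mul]
      gcongr
    rw [h5]
    linarith
  have h7 : t * (t * (m * ∑ i, v i ^ 2)) ≤ t * (t * (∑ i, (∑ j, A i j * v j) * v i + t * W)) := by
    calc t * (t * (m * ∑ i, v i ^ 2)) = m * (t ^ 2 * ∑ i, v i ^ 2) := by ring
      _ ≤ t * (t * ∑ i, (∑ j, A i j * v j) * v i + t ^ 2 * W) :=
        h1.trans (mul_le_mul_of_nonneg_left h2 ht0.le)
      _ = _ := by ring
  have h8 := le_of_mul_le_mul_left (le_of_mul_le_mul_left h7 ht0) ht0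
  linarith

end Taylor

/-! ### Invertibility of the Lyapunov operators -/

section Lyapunov

/-- A coercive matrix. -/
def Coercive {d : ℕ} (A : Fin d → Fin d → ℝ) (m : ℝ) : Prop :=
  ∀ v : Fin d → ℝ, m * ∑ i, v i ^ 2 ≤ ∑ i, (∑ j, A i j * v j) * v i

/-- In finite dimension an injective map has a bounded inverse. This turns an estimate on the
Lyapunov operator of a moment tensor into one on the tensor itself. -/
theorem LinearMap.exists_norm_le_of_injective {V : Type*} [NormedAddCommGroup V] [NormedSpace ℝ V]
    [FiniteDimensional ℝ V] (Φ : V →ₗ[ℝ] V) (h : ∀ X, Φ X = 0 → X = 0) :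
    ∃ K : ℝ, 0 ≤ K ∧ ∀ X, ‖X‖ ≤ K * ‖Φ X‖ := by
  obtain ⟨K, -, hK⟩ := Φ.exists_antilipschitzWith (LinearMap.ker_eq_bot'.2 h)
  exact ⟨K, K.2, fun X => hK.le_mul_norm (map_zero Φ) X⟩

theorem LinearMap.exists_eq_of_injective {V : Type*} [AddCommGroup V] [Module ℝ V]
    [FiniteDimensional ℝ V] (Φ : V →ₗ[ℝ] V) (h : ∀ X, Φ X = 0 → X = 0) (Y : V) :
    ∃ X, Φ X = Y :=
  LinearMap.injective_iff_surjective.1 (LinearMap.ker_eq_bot.1 (LinearMap.ker_eq_bot'.2 h)) Y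

variable {d : ℕ}

/-- The action of a matrix on vectors. -/
def lyapunovOne (A : Fin d → Fin d → ℝ) : (Fin d → ℝ) →ₗ[ℝ] (Fin d → ℝ) where
  toFun X i := ∑ j, A i j * X j
  map_add' X Y := by ext i; simp [mul_add, Finset.sum_add_distrib]
  map_smul' c X := by ext i; simp [Finset.mul_sum, mul_left_comm]

/-- The Lyapunov operator of a matrix on tensors of order two. -/
def lyapunovTwo (A : Fin d → Fin d → ℝ) :
    (Fin d → Fin d → ℝ) →ₗ[ℝ] (Fin d → Fin d → ℝ) where
  toFun X i j := ∑ l, (A i l * X l j + A j l * X i l)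
  map_add' X Y := by
    ext i j
    simp only [Pi.add_apply, ← Finset.sum_add_distrib]
    exact Finset.sum_congr rfl fun l _ => by ring
  map_smul' c X := by
    ext i j
    simp only [Pi.smul_apply, smul_eq_mul, RingHom.id_apply, Finset.mul_sum]
    exact Finset.sum_congr rfl fun l _ => by ring

/-- The Lyapunov operator of a matrix on tensors of order three. -/
def lyapunovThree (A : Fin d → Fin d → ℝ) :
    (Fin d → Fin d → Fin d → ℝ) →ₗ[ℝ] (Fin d → Fin d → Fin d → ℝ) where
  toFun X i j k := ∑ l, (A i l * X l j k + A j l * X i l k + A k l * X i j l)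
  map_add' X Y := by
    ext i j k
    simp only [Pi.add_apply, ← Finset.sum_add_distrib]
    exact Finset.sum_congr rfl fun l _ => by ring
  map_smul' c X := by
    ext i j k
    simp only [Pi.smul_apply, smul_eq_mul, RingHom.id_apply, Finset.mul_sum]
    exact Finset.sum_congr rfl fun l _ => by ring

variable {A : Fin d → Fin d → ℝ} {m : ℝ}

theorem Coercive.lyapunovOne_injective (hA : Coercive A m) (hm : 0 < m) (X : Fin d → ℝ)
    (hX : lyapunovOne A X = 0) : X = 0 := by
  have h := hA X
  have e : ∀ i, ∑ j, A i j * X j = 0 := fun i => congrFun hX i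
  simp only [e, zero_mul, Finset.sum_const_zero] at h
  have h0 : ∑ i, X i ^ 2 = 0 := by
    have : 0 ≤ ∑ i, X i ^ 2 := Finset.sum_nonneg fun i _ => sq_nonneg _
    nlinarith
  ext i
  exact pow_eq_zero_iff two_ne_zero |>.1
    ((Finset.sum_eq_zero_iff_of_nonneg fun i _ => sq_nonneg (X i)).1 h0 i (Finset.mem_univ i))

/-- Pair the image of X with X. Freezing all indices but one, coercivity bounds the contribution of
each slot below by m‖X‖², so the pairing is at least 2m‖X‖² in the Euclidean norm. No symmetry of A
or X is needed. -/
theorem Coercive.lyapunovTwo_injective (hA : Coercive A m) (hm : 0 < m) (X : Fin d → Fin d → ℝ)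
    (hX : lyapunovTwo A X = 0) : X = 0 := by
  set S : ℝ := ∑ i, ∑ j, X i j ^ 2 with hS
  have h1 : m * S ≤ ∑ i, ∑ j, (∑ l, A i l * X l j) * X i j := by
    rw [hS, Finset.sum_comm, Finset.mul_sum]
    conv_rhs => rw [Finset.sum_comm]
    exact Finset.sum_le_sum fun j _ => hA fun i => X i j
  have h2 : m * S ≤ ∑ i, ∑ j, (∑ l, A j l * X i l) * X i j := by
    rw [hS, Finset.mul_sum]
    exact Finset.sum_le_sum fun i _ => hA fun j => X i j
  have h3 : ∑ i, ∑ j, (∑ l, A i l * X l j) * X i j + ∑ i, ∑ j, (∑ l, A j l * X i l) * X i j =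
      ∑ i, ∑ j, lyapunovTwo A X i j * X i j := by
    simp only [← Finset.sum_add_distrib, ← add_mul, lyapunovTwo, LinearMap.coe_mk, AddHom.coe_mk]
  simp only [hX, Pi.zero_apply, zero_mul, Finset.sum_const_zero] at h3
  have hS0 : S ≤ 0 := by nlinarith
  ext i j
  have h4 : X i j ^ 2 ≤ S :=
    (Finset.single_le_sum (f := fun j => X i j ^ 2) (fun j _ => sq_nonneg _)
      (Finset.mem_univ j)).trans
    (Finset.single_le_sum (f := fun i => ∑ j, X i j ^ 2)
      (fun i _ => Finset.sum_nonneg fun j _ => sq_nonneg _) (Finset.mem_univ i))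
  exact pow_eq_zero_iff two_ne_zero |>.1 (le_antisymm (h4.trans hS0) (sq_nonneg _))

/-- The same pairing with three slots, each handled by reordering the sums so that the active index
is innermost. -/
theorem Coercive.lyapunovThree_injective (hA : Coercive A m) (hm : 0 < m)
    (X : Fin d → Fin d → Fin d → ℝ) (hX : lyapunovThree A X = 0) : X = 0 := by
  set S : ℝ := ∑ i, ∑ j, ∑ k, X i j k ^ 2 with hS
  have h1 : m * S ≤ ∑ i, ∑ j, ∑ k, (∑ l, A i l * X l j k) * X i j k := by
    have e : ∀ f : Fin d → Fin d → Fin d → ℝ,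
        ∑ i, ∑ j, ∑ k, f i j k = ∑ j, ∑ k, ∑ i, f i j k := fun f => by
      rw [Finset.sum_comm]
      exact Finset.sum_congr rfl fun j _ => Finset.sum_comm
    rw [hS, e fun i j k => X i j k ^ 2, e fun i j k => (∑ l, A i l * X l j k) * X i j k]
    simp only [Finset.mul_sum]
    refine Finset.sum_le_sum fun j _ => Finset.sum_le_sum fun k _ => ?_
    rw [← Finset.mul_sum]
    exact hA fun i => X i j k
  have h2 : m * S ≤ ∑ i, ∑ j, ∑ k, (∑ l, A j l * X i l k) * X i j k := by
    rw [hS, Finset.mul_sum]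
    refine Finset.sum_le_sum fun i _ => ?_
    rw [Finset.sum_comm, Finset.mul_sum]
    conv_rhs => rw [Finset.sum_comm]
    exact Finset.sum_le_sum fun k _ => hA fun j => X i j k
  have h3 : m * S ≤ ∑ i, ∑ j, ∑ k, (∑ l, A k l * X i j l) * X i j k := by
    rw [hS, Finset.mul_sum]
    refine Finset.sum_le_sum fun i _ => ?_
    rw [Finset.mul_sum]
    exact Finset.sum_le_sum fun j _ => hA fun k => X i j k
  have h4 : ∑ i, ∑ j, ∑ k, (∑ l, A i l * X l j k) * X i j k +
      ∑ i, ∑ j, ∑ k, (∑ l, A j l * X i l k) * X i j k +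
      ∑ i, ∑ j, ∑ k, (∑ l, A k l * X i j l) * X i j k =
      ∑ i, ∑ j, ∑ k, lyapunovThree A X i j k * X i j k := by
    simp only [← Finset.sum_add_distrib, ← add_mul, lyapunovThree, LinearMap.coe_mk, AddHom.coe_mk]
  simp only [hX, Pi.zero_apply, zero_mul, Finset.sum_const_zero] at h4
  have hS0 : S ≤ 0 := by nlinarith
  ext i j k
  have h5 : X i j k ^ 2 ≤ S :=
    ((Finset.single_le_sum (f := fun k => X i j k ^ 2) (fun k _ => sq_nonneg _)
      (Finset.mem_univ k)).trans
    (Finset.single_le_sum (f := fun j => ∑ k, X i j k ^ 2)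
      (fun j _ => Finset.sum_nonneg fun k _ => sq_nonneg _) (Finset.mem_univ j))).trans
    (Finset.single_le_sum (f := fun i => ∑ j, ∑ k, X i j k ^ 2)
      (fun i _ => Finset.sum_nonneg fun j _ => Finset.sum_nonneg fun k _ => sq_nonneg _)
      (Finset.mem_univ i))
  exact pow_eq_zero_iff two_ne_zero |>.1 (le_antisymm (h5.trans hS0) (sq_nonneg _))

end Lyapunov

/-! ### Calculus of means -/

section Mean

variable {α : Type*} [MeasurableSpace α]

/-- `f` is integrable with mean `c`. -/
def HasMean (μ : Measure α) (f : α → ℝ) (c : ℝ) : Prop := Integrable f μ ∧ ∫ x, f x ∂μ = c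

variable {μ : Measure α} {f g h : α → ℝ} {a b c : ℝ}

theorem MeasureTheory.Integrable.hasMean (hf : Integrable f μ) : HasMean μ f (∫ x, f x ∂μ) :=
  ⟨hf, rfl⟩

namespace HasMean

theorem add (hf : HasMean μ f a) (hg : HasMean μ g b) :
    HasMean μ (fun x => f x + g x) (a + b) :=
  ⟨hf.1.add hg.1, by rw [integral_add hf.1 hg.1, hf.2, hg.2]⟩

theorem sub (hf : HasMean μ f a) (hg : HasMean μ g b) :
    HasMean μ (fun x => f x - g x) (a - b) :=
  ⟨hf.1.sub hg.1, by rw [integral_sub hf.1 hg.1, hf.2, hg.2]⟩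

theorem const_mul (hf : HasMean μ f a) (c : ℝ) : HasMean μ (fun x => c * f x) (c * a) :=
  ⟨hf.1.const_mul c, by rw [integral_const_mul, hf.2]⟩

theorem const [IsProbabilityMeasure μ] (c : ℝ) : HasMean μ (fun _ => c) c :=
  ⟨integrable_const c, by simp⟩

theorem sum {ι : Type*} [Fintype ι] {f : ι → α → ℝ} {a : ι → ℝ}
    (hf : ∀ i, HasMean μ (f i) (a i)) : HasMean μ (fun x => ∑ i, f i x) (∑ i, a i) :=
  ⟨integrable_finsetSum _ fun i _ => (hf i).1, by
    rw [integral_finsetSum _ fun i _ => (hf i).1]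
    exact Finset.sum_congr rfl fun i _ => (hf i).2⟩

theorem congr (hf : HasMean μ f a) (h : ∀ x, f x = g x) : HasMean μ g a := by
  rwa [← funext h]

theorem unique (hf : HasMean μ f a) (hg : HasMean μ f b) : a = b := hf.2.symm.trans hg.2

theorem mono (hf : HasMean μ f a) (hg : HasMean μ g b) (h : ∀ x, f x ≤ g x) : a ≤ b := by
  rw [← hf.2, ← hg.2]
  exact integral_mono hf.1 hg.1 h

theorem abs_le (hf : HasMean μ f a) (hg : HasMean μ g b) (h : ∀ x, |f x| ≤ g x) : |a| ≤ b := by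
  rw [← hf.2, ← hg.2]
  exact norm_integral_le_of_norm_le (f := f) hg.1 (Filter.Eventually.of_forall h)

end HasMean

/-- Products of three functions dominated by a function in `L⁴` are integrable. -/
theorem integrable_mul_mul {u : α → ℝ} (hu : ∀ x, 1 ≤ u x) (hi : Integrable (fun x => u x ^ 4) μ)
    (hf : Measurable f) (hg : Measurable g) (hh : Measurable h) (hfu : ∀ x, |f x| ≤ u x)
    (hgu : ∀ x, |g x| ≤ u x) (hhu : ∀ x, |h x| ≤ u x) :
    Integrable (fun x => f x * g x * h x) μ := by
  refine hi.mono' ((hf.mul hg).mul hh).aestronglyMeasurable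
    (Filter.Eventually.of_forall fun x => ?_)
  have h0 : 0 ≤ u x := zero_le_one.trans (hu x)
  rw [Real.norm_eq_abs, abs_mul, abs_mul]
  calc |f x| * |g x| * |h x| ≤ u x * u x * u x := by
        gcongr
        exacts [hfu x, hgu x, hhu x]
    _ = u x ^ 3 := by ring
    _ ≤ u x ^ 4 := pow_le_pow_right₀ (hu x) (by norm_num)

end Mean

/-! ### Moment identities of a stationary law -/

section Stationary

/-- An invariant law of the SGDA chain with a finite fourth moment, for a Lipschitz operator and a
centred noise. -/
structure StationaryLaw {d : ℕ} {Ω : Type*} [MeasurableSpace Ω] (P : Measure Ω)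
    (F : Eucl d → Eucl d) (N : Eucl d → Ω → Eucl d) (xs : Eucl d) (L : ℝ≥0) (s₂ s₄ γ : ℝ)
    (π : Measure (Eucl d)) : Prop where
  prob : IsProbabilityMeasure P
  probπ : IsProbabilityMeasure π
  zero : F xs = 0
  lipschitz : LipschitzWith L F
  noise : CenteredNoise P N s₂ s₄
  measurable_cov : Measurable (covTensor P N)
  four : Integrable (fun x => ‖x - xs‖ ^ 4) π
  map_eq : (π.prod P).map (fun p => p.1 - γ • (F p.1 + N p.1 p.2)) = π

namespace StationaryLaw

variable {d : ℕ} {Ω : Type*}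
  {F : Eucl d → Eucl d} {N : Eucl d → Ω → Eucl d} {xs : Eucl d} {L : ℝ≥0} {s₂ s₄ γ : ℝ}

theorem add_add_pow_four_le (x y z : ℝ) :
    (x + y + z) ^ 4 ≤ 27 * (x ^ 4 + y ^ 4 + z ^ 4) := by
  have h : ∀ a b c : ℝ, (a + b + c) ^ 2 ≤ 3 * (a ^ 2 + b ^ 2 + c ^ 2) := fun a b c => by
    nlinarith [sq_nonneg (a - b), sq_nonneg (b - c), sq_nonneg (a - c)]
  calc (x + y + z) ^ 4 = ((x + y + z) ^ 2) ^ 2 := by ring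
    _ ≤ (3 * (x ^ 2 + y ^ 2 + z ^ 2)) ^ 2 := by gcongr; exact h x y z
    _ = 9 * (x ^ 2 + y ^ 2 + z ^ 2) ^ 2 := by ring
    _ ≤ 9 * (3 * ((x ^ 2) ^ 2 + (y ^ 2) ^ 2 + (z ^ 2) ^ 2)) := by gcongr; exact h _ _ _
    _ = _ := by ring

/-- The function dominating displacement and increments. -/
noncomputable def weight (N : Eucl d → Ω → Eucl d) (xs : Eucl d) (L : ℝ≥0) (p : Eucl d × Ω) : ℝ :=
  (L + 1) * (1 + ‖p.1 - xs‖ + ‖N p.1 p.2‖)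

theorem one_le_weight (p : Eucl d × Ω) : 1 ≤ weight N xs L p := by
  have h1 : (0 : ℝ) ≤ L := L.2
  have h2 : 0 ≤ ‖p.1 - xs‖ := norm_nonneg _
  have h3 : 0 ≤ ‖N p.1 p.2‖ := norm_nonneg _
  exact one_le_mul_of_one_le_of_one_le (by linarith) (by linarith)

theorem abs_sub_apply_le (x xs : Eucl d) (i : Fin d) : |(x - xs) i| ≤ ‖x - xs‖ :=
  PiLp.norm_apply_le (x - xs) i

theorem abs_displacement_le_weight (p : Eucl d × Ω) (i : Fin d) :
    |(p.1 - xs) i| ≤ weight N xs L p := by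
  have h0 := abs_sub_apply_le p.1 xs i
  have h1 : (0 : ℝ) ≤ L := L.2
  have h2 : 0 ≤ ‖p.1 - xs‖ := norm_nonneg _
  have h3 : 0 ≤ ‖N p.1 p.2‖ := norm_nonneg _
  unfold weight
  nlinarith [mul_nonneg h1 h2, mul_nonneg h1 h3]

variable [MeasurableSpace Ω] {P : Measure Ω} {π : Measure (Eucl d)}

theorem norm_le (H : StationaryLaw P F N xs L s₂ s₄ γ π) (x : Eucl d) :
    ‖F x‖ ≤ L * ‖x - xs‖ := by
  simpa [H.zero] using H.lipschitz.norm_sub_le x xs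

theorem abs_apply_le (H : StationaryLaw P F N xs L s₂ s₄ γ π) (x : Eucl d) (i : Fin d) :
    |F x i| ≤ L * ‖x - xs‖ :=
  (PiLp.norm_apply_le (F x) i).trans (H.norm_le x)

theorem abs_increment_le_weight (H : StationaryLaw P F N xs L s₂ s₄ γ π) (p : Eucl d × Ω)
    (i : Fin d) : |F p.1 i + N p.1 p.2 i| ≤ weight N xs L p := by
  have h0 := H.abs_apply_le p.1 i
  have h4 : |N p.1 p.2 i| ≤ ‖N p.1 p.2‖ := PiLp.norm_apply_le (N p.1 p.2) i
  have h5 := abs_add_le (F p.1 i) (N p.1 p.2 i)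
  have h1 : (0 : ℝ) ≤ L := L.2
  have h2 : 0 ≤ ‖p.1 - xs‖ := norm_nonneg _
  have h3 : 0 ≤ ‖N p.1 p.2‖ := norm_nonneg _
  unfold weight
  nlinarith [mul_nonneg h1 h2, mul_nonneg h1 h3]

/-- The noise is bounded in L⁴ uniformly in the state. The estimate depends on γ only through the
fourth moment of π, so it becomes uniform in γ later. -/
theorem weight_pow_four (H : StationaryLaw P F N xs L s₂ s₄ γ π) :
    Integrable (fun p => weight N xs L p ^ 4) (π.prod P) ∧
      ∫ p, weight N xs L p ^ 4 ∂(π.prod P) ≤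
        (L + 1) ^ 4 * (27 * (1 + ∫ x, ‖x - xs‖ ^ 4 ∂π + s₄)) := by
  have := H.prob
  have := H.probπ
  have hm := H.noise.measurable
  have i1 : Integrable (fun p : Eucl d × Ω => ‖p.1 - xs‖ ^ 4) (π.prod P) := H.four.comp_fst P
  have hle : ∀ x, ∫ ω, ‖‖N x ω‖ ^ 4‖ ∂P ≤ s₄ := fun x => by
    simpa using H.noise.fourth_moment x
  have hNm : Measurable (fun p : Eucl d × Ω => ‖N p.1 p.2‖ ^ 4) := by fun_prop
  have i2 : Integrable (fun p : Eucl d × Ω => ‖N p.1 p.2‖ ^ 4) (π.prod P) := by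
    rw [integrable_prod_iff hNm.aestronglyMeasurable]
    refine ⟨Filter.Eventually.of_forall fun x => H.noise.integrable_four x,
      Integrable.of_bound (C := s₄) ?_ (Filter.Eventually.of_forall fun x => ?_)⟩
    · exact hNm.norm.stronglyMeasurable.integral_prod_right.aestronglyMeasurable
    · rw [Real.norm_eq_abs, abs_of_nonneg (integral_nonneg fun _ => norm_nonneg _)]
      exact hle x
  have b : ∀ p : Eucl d × Ω, weight N xs L p ^ 4 ≤
      (L + 1) ^ 4 * (27 * (1 + ‖p.1 - xs‖ ^ 4 + ‖N p.1 p.2‖ ^ 4)) := fun p => by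
    rw [weight, mul_pow]
    have := add_add_pow_four_le 1 ‖p.1 - xs‖ ‖N p.1 p.2‖
    rw [one_pow] at this
    gcongr
  have i3 := ((((HasMean.const (μ := π.prod P) 1).add i1.hasMean).add i2.hasMean).const_mul
    27).const_mul (((L : ℝ) + 1) ^ 4)
  have hwm : Measurable (fun p => weight N xs L p ^ 4) := by unfold weight; fun_prop
  have i4 : Integrable (fun p => weight N xs L p ^ 4) (π.prod P) :=
    i3.1.mono' hwm.aestronglyMeasurable (Filter.Eventually.of_forall fun p => by
      rw [Real.norm_eq_abs, abs_of_nonneg (by positivity)]; exact b p)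
  refine ⟨i4, (i4.hasMean.mono i3 b).trans ?_⟩
  have e1 : ∫ p : Eucl d × Ω, ‖p.1 - xs‖ ^ 4 ∂(π.prod P) = ∫ x, ‖x - xs‖ ^ 4 ∂π := by
    rw [integral_prod _ i1]; simp
  have e2 : ∫ p : Eucl d × Ω, ‖N p.1 p.2‖ ^ 4 ∂(π.prod P) ≤ s₄ := by
    rw [integral_prod _ i2]
    have := integral_mono i2.integral_prod_left (integrable_const s₄)
      fun x => H.noise.fourth_moment x
    simpa using this
  rw [e1]
  gcongr

theorem noise_hasMean (H : StationaryLaw P F N xs L s₂ s₄ γ π) (x : Eucl d) (i : Fin d) :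
    HasMean P (fun ω => N x ω i) 0 := by
  have := H.prob
  have hi := H.noise.integrable x
  refine ⟨(EuclideanSpace.proj (𝕜 := ℝ) i).integrable_comp hi, ?_⟩
  have := (EuclideanSpace.proj (𝕜 := ℝ) i).integral_comp_comm hi
  rw [H.noise.integral_eq_zero, map_zero] at this
  exact this

theorem noise_mul_hasMean (H : StationaryLaw P F N xs L s₂ s₄ γ π) (x : Eucl d) (i j : Fin d) :
    HasMean P (fun ω => N x ω i * N x ω j) (covTensor P N x i j) := by
  have := H.prob
  have hm := H.noise.measurable_apply x
  refine ⟨(H.noise.integrable_sq x).mono' (by fun_prop) (Filter.Eventually.of_forall fun ω => ?_),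
    rfl⟩
  rw [norm_mul, sq]
  exact mul_le_mul (PiLp.norm_apply_le (N x ω) i) (PiLp.norm_apply_le (N x ω) j)
    (norm_nonneg _) (norm_nonneg _)

theorem increment_hasMean (H : StationaryLaw P F N xs L s₂ s₄ γ π) (x : Eucl d) (i : Fin d) :
    HasMean P (fun ω => F x i + N x ω i) (F x i) := by
  have := H.prob
  simpa using (HasMean.const (F x i)).add (H.noise_hasMean x i)

theorem increment_mul_hasMean (H : StationaryLaw P F N xs L s₂ s₄ γ π) (x : Eucl d)
    (i j : Fin d) : HasMean P (fun ω => (F x i + N x ω i) * (F x j + N x ω j))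
      (F x i * F x j + covTensor P N x i j) := by
  have := H.prob
  have h := (((HasMean.const (μ := P) (F x i * F x j)).add
    ((H.noise_hasMean x j).const_mul (F x i))).add
    ((H.noise_hasMean x i).const_mul (F x j))).add (H.noise_mul_hasMean x i j)
  rw [mul_zero, mul_zero, add_zero, add_zero] at h
  exact h.congr fun ω => by ring

/-- Fubini: the noise is averaged out at a fixed state. -/
theorem hasMean_of_prod (H : StationaryLaw P F N xs L s₂ s₄ γ π) {f : Eucl d × Ω → ℝ} {c : ℝ}
    (hf : HasMean (π.prod P) f c) {g : Eucl d → ℝ} (hg : ∀ x, HasMean P (fun ω => f (x, ω)) (g x)) :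
    HasMean π g c := by
  have := H.prob
  have := H.probπ
  have e : (fun x => ∫ ω, f (x, ω) ∂P) = g := funext fun x => (hg x).2
  refine ⟨e ▸ hf.1.integral_prod_left, ?_⟩
  rw [← hf.2, integral_prod _ hf.1, e]

theorem hasMean_fst (H : StationaryLaw P F N xs L s₂ s₄ γ π) {f : Eucl d → ℝ} {c : ℝ}
    (hf : HasMean π f c) : HasMean (π.prod P) (fun p => f p.1) c := by
  have := H.prob
  have := H.probπ
  refine ⟨hf.1.comp_fst P, ?_⟩
  rw [integral_prod _ (hf.1.comp_fst P), ← hf.2]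
  simp

/-- Stationarity on functions. Each moment identity compares this mean with the one obtained by
expanding f after the step in powers of γ. -/
theorem hasMean_step (H : StationaryLaw P F N xs L s₂ s₄ γ π) {f : Eucl d → ℝ} {c : ℝ}
    (hfm : Measurable f) (hf : HasMean π f c) :
    HasMean (π.prod P) (fun p => f (p.1 - γ • (F p.1 + N p.1 p.2))) c := by
  have hN := H.noise.measurable
  have hF := H.lipschitz.continuous.measurable
  have hm : Measurable (fun p : Eucl d × Ω => p.1 - γ • (F p.1 + N p.1 p.2)) := by fun_prop
  rw [← H.map_eq] at hf
  refine ⟨(integrable_map_measure hfm.aestronglyMeasurable hm.aemeasurable).1 hf.1, ?_⟩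
  rw [← hf.2, integral_map hm.aemeasurable hfm.aestronglyMeasurable]

theorem step_sub_apply (x u : Eucl d) (f : Eucl d) (i : Fin d) :
    (x - γ • (f + u) - xs) i = (x - xs) i - γ * (f i + u i) := by
  simp; ring

/-- The displacement from the zero is measurable and dominated by the weight. -/
theorem displacement_dom (N : Eucl d → Ω → Eucl d) (xs : Eucl d) (L : ℝ≥0) (i : Fin d) :
    Measurable (fun p : Eucl d × Ω => (p.1 - xs) i) ∧
      ∀ p : Eucl d × Ω, |(p.1 - xs) i| ≤ weight N xs L p :=
  ⟨by fun_prop, fun p => abs_displacement_le_weight p i⟩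

theorem increment_dom (H : StationaryLaw P F N xs L s₂ s₄ γ π) (i : Fin d) :
    Measurable (fun p : Eucl d × Ω => F p.1 i + N p.1 p.2 i) ∧
      ∀ p : Eucl d × Ω, |F p.1 i + N p.1 p.2 i| ≤ weight N xs L p := by
  have hN := H.noise.measurable
  have hF := H.lipschitz.continuous.measurable
  exact ⟨by fun_prop, fun p => H.abs_increment_le_weight p i⟩

/-- The constant 1 fills the empty slots, so that `integrable_of_dom` also covers products of one or
two factors. -/
theorem one_dom (N : Eucl d → Ω → Eucl d) (xs : Eucl d) (L : ℝ≥0) :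
    Measurable (fun _ : Eucl d × Ω => (1 : ℝ)) ∧
      ∀ p : Eucl d × Ω, |(1 : ℝ)| ≤ weight N xs L p :=
  ⟨measurable_const, fun p => by rw [abs_one]; exact one_le_weight p⟩

theorem integrable_of_dom (H : StationaryLaw P F N xs L s₂ s₄ γ π) {f g h : Eucl d × Ω → ℝ}
    (hf : Measurable f ∧ ∀ p, |f p| ≤ weight N xs L p)
    (hg : Measurable g ∧ ∀ p, |g p| ≤ weight N xs L p)
    (hh : Measurable h ∧ ∀ p, |h p| ≤ weight N xs L p) :
    HasMean (π.prod P) (fun p => f p * g p * h p) (∫ p, f p * g p * h p ∂(π.prod P)) :=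
  (integrable_mul_mul one_le_weight H.weight_pow_four.1 hf.1 hg.1 hh.1 hf.2 hg.2 hh.2).hasMean

/-- Monomials of degree three in the displacement have a mean. -/
theorem three_hasMean (H : StationaryLaw P F N xs L s₂ s₄ γ π) (i j k : Fin d) :
    HasMean π (fun x => (x - xs) i * (x - xs) j * (x - xs) k)
      (∫ x, (x - xs) i * (x - xs) j * (x - xs) k ∂π) := by
  have := H.prob
  have h := H.hasMean_of_prod (H.integrable_of_dom (displacement_dom N xs L i)
    (displacement_dom N xs L j) (displacement_dom N xs L k))
    fun x => HasMean.const ((x - xs) i * (x - xs) j * (x - xs) k)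
  exact h.1.hasMean

theorem two_hasMean (H : StationaryLaw P F N xs L s₂ s₄ γ π) (i j : Fin d) :
    HasMean π (fun x => (x - xs) i * (x - xs) j) (∫ x, (x - xs) i * (x - xs) j ∂π) := by
  have := H.prob
  have h := H.hasMean_of_prod (H.integrable_of_dom (displacement_dom N xs L i)
    (displacement_dom N xs L j) (one_dom N xs L))
    fun x => HasMean.const ((x - xs) i * (x - xs) j * 1)
  exact (h.congr fun x => mul_one _).1.hasMean

theorem one_hasMean (H : StationaryLaw P F N xs L s₂ s₄ γ π) (i : Fin d) :
    HasMean π (fun x => (x - xs) i) (∫ x, (x - xs) i ∂π) := by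
  have := H.prob
  have h := H.hasMean_of_prod (H.integrable_of_dom (displacement_dom N xs L i)
    (one_dom N xs L) (one_dom N xs L))
    fun x => HasMean.const ((x - xs) i * 1 * 1)
  exact (h.congr (g := fun x => (x - xs) i) fun x => by ring).1.hasMean

/-- The first moment identity of a stationary law. -/
theorem first_moment (H : StationaryLaw P F N xs L s₂ s₄ γ π) (hγ : γ ≠ 0) (i : Fin d) :
    HasMean π (fun x => F x i) 0 := by
  have hZ := H.one_hasMean i
  have h1 := H.hasMean_step (f := fun x => (x - xs) i) (by fun_prop) hZ
  have hG := H.integrable_of_dom (H.increment_dom i) (one_dom N xs L) (one_dom N xs L)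
  have h2 := ((H.hasMean_fst hZ).sub (hG.const_mul γ)).congr (g := fun p =>
    (p.1 - γ • (F p.1 + N p.1 p.2) - xs) i) fun p => by rw [step_sub_apply]; ring
  have e := h1.unique h2
  have e2 := (mul_eq_zero.1 (by linarith : γ * _ = 0)).resolve_left hγ
  rw [e2] at hG
  refine H.hasMean_of_prod hG fun x => ?_
  exact (H.increment_hasMean x i).congr fun ω => by ring

/-- The second moment identity of a stationary law. -/
theorem second_moment (H : StationaryLaw P F N xs L s₂ s₄ γ π) (hγ : γ ≠ 0) (i j : Fin d) :
    ∃ c, HasMean π (fun x => F x i * (x - xs) j + F x j * (x - xs) i) (γ * c) ∧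
      HasMean π (fun x => F x i * F x j + covTensor P N x i j) c := by
  have hZ := H.two_hasMean i j
  have h1 := H.hasMean_step (f := fun x => (x - xs) i * (x - xs) j) (by fun_prop) hZ
  have hGi := H.integrable_of_dom (H.increment_dom i) (displacement_dom N xs L j) (one_dom N xs L)
  have hGj := H.integrable_of_dom (H.increment_dom j) (displacement_dom N xs L i) (one_dom N xs L)
  have hGG := H.integrable_of_dom (H.increment_dom i) (H.increment_dom j) (one_dom N xs L)
  have hG := hGi.add hGj
  have h2 := (((H.hasMean_fst hZ).sub (hG.const_mul γ)).add (hGG.const_mul (γ ^ 2))).congr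
    (g := fun p => (p.1 - γ • (F p.1 + N p.1 p.2) - xs) i *
      (p.1 - γ • (F p.1 + N p.1 p.2) - xs) j) fun p => by
        rw [step_sub_apply, step_sub_apply]; ring
  have e := h1.unique h2
  set a := ∫ p, (F p.1 i + N p.1 p.2 i) * (p.1 - xs) j * 1 ∂(π.prod P) +
    ∫ p, (F p.1 j + N p.1 p.2 j) * (p.1 - xs) i * 1 ∂(π.prod P)
  set c := ∫ p, (F p.1 i + N p.1 p.2 i) * (F p.1 j + N p.1 p.2 j) * 1 ∂(π.prod P)
  -- The comparison of means reads 0 = -γa + γ²c.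
  have ea : a = γ * c := mul_left_cancel₀ hγ (by linarith)
  rw [ea] at hG
  refine ⟨c, H.hasMean_of_prod hG fun x => ?_, H.hasMean_of_prod hGG fun x => ?_⟩
  · refine ((((H.increment_hasMean x i).const_mul ((x - xs) j)).add
      ((H.increment_hasMean x j).const_mul ((x - xs) i))).congr fun ω => by ring : HasMean P _ _)
      |>.imp_right fun h => h.trans (by ring)
  · exact (H.increment_mul_hasMean x i j).congr fun ω => by ring

/-- The third moment identity of a stationary law. -/
theorem third_moment (H : StationaryLaw P F N xs L s₂ s₄ γ π) (hγ : γ ≠ 0) (i j k : Fin d) :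
    ∃ c r, HasMean π (fun x => F x i * ((x - xs) j * (x - xs) k) +
        F x j * ((x - xs) i * (x - xs) k) + F x k * ((x - xs) i * (x - xs) j))
        (γ * c - γ ^ 2 * r) ∧
      HasMean π (fun x => (F x i * F x j + covTensor P N x i j) * (x - xs) k +
        (F x i * F x k + covTensor P N x i k) * (x - xs) j +
        (F x j * F x k + covTensor P N x j k) * (x - xs) i) c ∧
      |r| ≤ ∫ p, weight N xs L p ^ 4 ∂(π.prod P) := by
  have := H.prob
  have hZ := H.three_hasMean i j k
  have h1 := H.hasMean_step (f := fun x => (x - xs) i * (x - xs) j * (x - xs) k) (by fun_prop) hZ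
  have zi := displacement_dom N xs L i
  have zj := displacement_dom N xs L j
  have zk := displacement_dom N xs L k
  have gi := H.increment_dom i
  have gj := H.increment_dom j
  have gk := H.increment_dom k
  have hA := ((H.integrable_of_dom gi zj zk).add (H.integrable_of_dom gj zi zk)).add
    (H.integrable_of_dom gk zi zj)
  have hB := ((H.integrable_of_dom gi gj zk).add (H.integrable_of_dom gi gk zj)).add
    (H.integrable_of_dom gj gk zi)
  have hR := H.integrable_of_dom gi gj gk
  have h2 := ((((H.hasMean_fst hZ).sub (hA.const_mul γ)).add (hB.const_mul (γ ^ 2))).sub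
    (hR.const_mul (γ ^ 3))).congr
    (g := fun p => (p.1 - γ • (F p.1 + N p.1 p.2) - xs) i *
      (p.1 - γ • (F p.1 + N p.1 p.2) - xs) j * (p.1 - γ • (F p.1 + N p.1 p.2) - xs) k)
      fun p => by rw [step_sub_apply, step_sub_apply, step_sub_apply]; ring
  have e := h1.unique h2
  generalize hr : ∫ p, (F p.1 i + N p.1 p.2 i) * (F p.1 j + N p.1 p.2 j) *
    (F p.1 k + N p.1 p.2 k) ∂(π.prod P) = r at *
  obtain ⟨a, ha⟩ : ∃ a, HasMean (π.prod P) _ a := ⟨_, hA⟩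
  obtain ⟨c, hc⟩ : ∃ c, HasMean (π.prod P) _ c := ⟨_, hB⟩
  rw [ha.unique hA |>.symm, hc.unique hB |>.symm] at e
  -- The comparison of means reads 0 = -γa + γ²c - γ³r. The third moment r of the increment only
  -- needs to be bounded, since it enters at order γ².
  have ea : a = γ * c - γ ^ 2 * r := mul_left_cancel₀ hγ (by linarith)
  rw [ea] at ha
  refine ⟨c, r, H.hasMean_of_prod ha fun x => ?_, H.hasMean_of_prod hc fun x => ?_,
    hR.abs_le H.weight_pow_four.1.hasMean fun p => ?_⟩
  · exact ((((H.increment_hasMean x i).const_mul ((x - xs) j * (x - xs) k)).add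
      ((H.increment_hasMean x j).const_mul ((x - xs) i * (x - xs) k))).add
      ((H.increment_hasMean x k).const_mul ((x - xs) i * (x - xs) j))).congr
      (fun ω => by ring) |>.imp_right fun h => h.trans (by ring)
  · exact ((((H.increment_mul_hasMean x i j).const_mul ((x - xs) k)).add
      ((H.increment_mul_hasMean x i k).const_mul ((x - xs) j))).add
      ((H.increment_mul_hasMean x j k).const_mul ((x - xs) i))).congr
      (fun ω => by ring) |>.imp_right fun h => h.trans (by ring)
  · have h1 := one_le_weight (N := N) (xs := xs) (L := L) p
    have h0 : 0 ≤ weight N xs L p := zero_le_one.trans h1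
    rw [abs_mul, abs_mul]
    calc _ ≤ weight N xs L p * weight N xs L p * weight N xs L p := by
          gcongr
          exacts [gi.2 p, gj.2 p, gk.2 p]
      _ = weight N xs L p ^ 3 := by ring
      _ ≤ weight N xs L p ^ 4 := pow_le_pow_right₀ h1 (by norm_num)

end StationaryLaw

end Stationary

/-! ### Orders of magnitude of the moments -/

section Expansion

theorem abs_sum_mul_le {ι : Type*} [Fintype ι] {b x : ι → ℝ} {t : ℝ} (h : ∀ i, |x i| ≤ t) :
    |∑ i, b i * x i| ≤ (∑ i, |b i|) * t := by
  rw [Finset.sum_mul]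
  refine (Finset.abs_sum_le_sum_abs _ _).trans (Finset.sum_le_sum fun i _ => ?_)
  rw [abs_mul]
  exact mul_le_mul_of_nonneg_left (h i) (abs_nonneg _)

theorem abs_sum_sum_mul_le {ι : Type*} [Fintype ι] {b x : ι → ι → ℝ} {t : ℝ}
    (h : ∀ i j, |x i j| ≤ t) : |∑ i, ∑ j, b i j * x i j| ≤ (∑ i, ∑ j, |b i j|) * t := by
  rw [Finset.sum_mul]
  exact (Finset.abs_sum_le_sum_abs _ _).trans (Finset.sum_le_sum fun i _ => abs_sum_mul_le (h i))

theorem abs_sum_sum_sum_mul_le {ι : Type*} [Fintype ι] {b x : ι → ι → ι → ℝ} {t : ℝ}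
    (h : ∀ i j k, |x i j k| ≤ t) :
    |∑ i, ∑ j, ∑ k, b i j k * x i j k| ≤ (∑ i, ∑ j, ∑ k, |b i j k|) * t := by
  rw [Finset.sum_mul]
  exact (Finset.abs_sum_le_sum_abs _ _).trans
    (Finset.sum_le_sum fun i _ => abs_sum_sum_mul_le (h i))

variable {d : ℕ} {Ω : Type*} [MeasurableSpace Ω]

/-- Coefficients of Taylor expansions of an operator and of the covariance of a noise, with global
bounds for the remainders. -/
structure TaylorCoefficients (P : Measure Ω) (F : Eucl d → Eucl d) (N : Eucl d → Ω → Eucl d)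
    (xs : Eucl d) (A : Fin d → Fin d → ℝ) (B : Fin d → Fin d → Fin d → ℝ)
    (D : Fin d → Fin d → Fin d → Fin d → ℝ) (C : Fin d → Fin d → ℝ)
    (C' : Fin d → Fin d → Fin d → ℝ) (K : ℝ) : Prop where
  nonneg : 0 ≤ K
  one : ∀ x i, |F x i - ∑ j, A i j * (x - xs) j| ≤ K * ‖x - xs‖ ^ 2
  two : ∀ x i, |F x i - (∑ j, A i j * (x - xs) j +
    ∑ j, ∑ k, B i j k * ((x - xs) j * (x - xs) k))| ≤ K * ‖x - xs‖ ^ 3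
  three : ∀ x i, |F x i - (∑ j, A i j * (x - xs) j +
    ∑ j, ∑ k, B i j k * ((x - xs) j * (x - xs) k) +
    ∑ j, ∑ k, ∑ l, D i j k l * ((x - xs) j * (x - xs) k * (x - xs) l))| ≤ K * ‖x - xs‖ ^ 4
  cov_zero : ∀ x i j, |covTensor P N x i j - C i j| ≤ K * ‖x - xs‖
  cov_one : ∀ x i j, |covTensor P N x i j - (C i j + ∑ k, C' i j k * (x - xs) k)| ≤
    K * ‖x - xs‖ ^ 2

/-- A stationary law with step size at most one and a small fourth moment. -/
structure ConcentratedLaw (P : Measure Ω) (F : Eucl d → Eucl d) (N : Eucl d → Ω → Eucl d)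
    (xs : Eucl d) (L : ℝ≥0) (s₂ s₄ K₄ γ : ℝ) (π : Measure (Eucl d)) : Prop
    extends StationaryLaw P F N xs L s₂ s₄ γ π where
  pos : 0 < γ
  le_one : γ ≤ 1
  four_le : ∫ x, ‖x - xs‖ ^ 4 ∂π ≤ K₄ * γ ^ 2

/-- The first moments of the displacement. -/
noncomputable def momentOne (π : Measure (Eucl d)) (xs : Eucl d) (i : Fin d) : ℝ :=
  ∫ x, (x - xs) i ∂π

/-- The second moments of the displacement. -/
noncomputable def momentTwo (π : Measure (Eucl d)) (xs : Eucl d) (i j : Fin d) : ℝ :=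
  ∫ x, (x - xs) i * (x - xs) j ∂π

/-- The third moments of the displacement. -/
noncomputable def momentThree (π : Measure (Eucl d)) (xs : Eucl d) (i j k : Fin d) : ℝ :=
  ∫ x, (x - xs) i * (x - xs) j * (x - xs) k ∂π

namespace ConcentratedLaw

variable {P : Measure Ω} {F : Eucl d → Eucl d} {N : Eucl d → Ω → Eucl d} {xs : Eucl d} {L : ℝ≥0}
  {s₂ s₄ K₄ γ : ℝ} {π : Measure (Eucl d)} {A : Fin d → Fin d → ℝ}
  {B : Fin d → Fin d → Fin d → ℝ} {D : Fin d → Fin d → Fin d → Fin d → ℝ}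
  {C : Fin d → Fin d → ℝ} {C' : Fin d → Fin d → Fin d → ℝ} {K m : ℝ}

theorem hasMean_four (H : ConcentratedLaw P F N xs L s₂ s₄ K₄ γ π) :
    ∃ a, HasMean π (fun x => ‖x - xs‖ ^ 4) a ∧ 0 ≤ a ∧ a ≤ K₄ * γ ^ 2 :=
  ⟨_, H.four.hasMean, integral_nonneg fun _ => by positivity, H.four_le⟩

theorem nonneg (H : ConcentratedLaw P F N xs L s₂ s₄ K₄ γ π) : 0 ≤ K₄ := by
  obtain ⟨a, -, h0, h1⟩ := H.hasMean_four
  exact nonneg_of_mul_nonneg_left (h0.trans h1) (pow_pos H.pos 2)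

/-- Young's inequality at scale γ, t² ≤ γ + t⁴/γ, turns a fourth moment of order γ² into a second
moment of order γ. -/
theorem hasMean_two (H : ConcentratedLaw P F N xs L s₂ s₄ K₄ γ π) :
    ∃ a, HasMean π (fun x => ‖x - xs‖ ^ 2) a ∧ 0 ≤ a ∧ a ≤ (1 + K₄) * γ := by
  have := H.probπ
  have hγ := H.pos
  obtain ⟨a, ha, h0, h1⟩ := H.hasMean_four
  have hb := ((HasMean.const (μ := π) γ).add (ha.const_mul γ⁻¹))
  have hle : ∀ x : Eucl d, ‖x - xs‖ ^ 2 ≤ γ + γ⁻¹ * ‖x - xs‖ ^ 4 := fun x => by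
    have e : γ + γ⁻¹ * ‖x - xs‖ ^ 4 - ‖x - xs‖ ^ 2 =
        γ⁻¹ * ((‖x - xs‖ ^ 2 - γ / 2) ^ 2 + 3 / 4 * γ ^ 2) := by field_simp; ring
    have : 0 ≤ γ⁻¹ * ((‖x - xs‖ ^ 2 - γ / 2) ^ 2 + 3 / 4 * γ ^ 2) := by positivity
    linarith
  have hi : Integrable (fun x => ‖x - xs‖ ^ 2) π :=
    hb.1.mono' (by fun_prop) (Filter.Eventually.of_forall fun x => by
      rw [Real.norm_eq_abs, abs_of_nonneg (by positivity)]; exact hle x)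
  refine ⟨_, hi.hasMean, integral_nonneg fun _ => by positivity, (hi.hasMean.mono hb hle).trans ?_⟩
  have h2 : γ⁻¹ * a ≤ K₄ * γ := by
    rw [inv_mul_le_iff₀ hγ]; linarith
  linarith

/-- From t³ ≤ t² + t⁴. Order γ is cruder than γ^(3/2), but this moment is only used with a further
factor γ. -/
theorem hasMean_three (H : ConcentratedLaw P F N xs L s₂ s₄ K₄ γ π) :
    ∃ a, HasMean π (fun x => ‖x - xs‖ ^ 3) a ∧ 0 ≤ a ∧ a ≤ (1 + 2 * K₄) * γ := by
  have := H.probπ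
  have hγ := H.pos
  obtain ⟨a, ha, h0, h1⟩ := H.hasMean_four
  obtain ⟨b, hb, h2, h3⟩ := H.hasMean_two
  have hle : ∀ x : Eucl d, ‖x - xs‖ ^ 3 ≤ ‖x - xs‖ ^ 2 + ‖x - xs‖ ^ 4 := fun x => by
    nlinarith [mul_nonneg (sq_nonneg ‖x - xs‖) (sq_nonneg (‖x - xs‖ - 1 / 2)),
      sq_nonneg ‖x - xs‖]
  have hi : Integrable (fun x => ‖x - xs‖ ^ 3) π :=
    (hb.add ha).1.mono' (by fun_prop) (Filter.Eventually.of_forall fun x => by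
      rw [Real.norm_eq_abs, abs_of_nonneg (by positivity)]; exact hle x)
  refine ⟨_, hi.hasMean, integral_nonneg fun _ => by positivity,
    (hi.hasMean.mono (hb.add ha) hle).trans ?_⟩
  have h4 : K₄ * γ ^ 2 ≤ K₄ * γ := by
    have := H.nonneg
    have : γ ^ 2 ≤ γ := by nlinarith [H.le_one]
    gcongr
  linarith

theorem abs_mul_apply_le {x : Eucl d} {f b : ℝ} {n : ℕ} (h : |f| ≤ b * ‖x - xs‖ ^ n)
    (j : Fin d) : |f * (x - xs) j| ≤ b * ‖x - xs‖ ^ (n + 1) := by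
  rw [abs_mul, pow_succ, ← mul_assoc]
  exact mul_le_mul h (PiLp.norm_apply_le (x - xs) j) (abs_nonneg _) ((abs_nonneg _).trans h)

/-- The mean displacement is of the order of the step size. -/
theorem exists_momentOne_le (hT : TaylorCoefficients P F N xs A B D C C' K) (hA : Coercive A m)
    (hm : 0 < m) (L : ℝ≥0) (s₂ s₄ K₄ : ℝ) :
    ∃ K₁ : ℝ, ∀ γ π, ConcentratedLaw P F N xs L s₂ s₄ K₄ γ π →
      ∀ i, |momentOne π xs i| ≤ K₁ * γ := by
  obtain ⟨k, hk0, hk⟩ := LinearMap.exists_norm_le_of_injective _ (hA.lyapunovOne_injective hm)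
  refine ⟨k * (K * (1 + K₄)), fun γ π H i => ?_⟩
  obtain ⟨a, ha, h0, h1⟩ := H.hasMean_two
  have hγ := H.pos
  have hK := hT.nonneg
  have hK4 := H.nonneg
  have h2 : ‖lyapunovOne A (momentOne π xs)‖ ≤ K * (1 + K₄) * γ := by
    refine (pi_norm_le_iff_of_nonneg (by positivity)).2 fun i => ?_
    -- As E F = 0, the vector A E z equals up to sign the mean Taylor remainder, of order E‖z‖².
    have h3 := ((H.first_moment hγ.ne' i).sub
      (HasMean.sum fun j => (H.one_hasMean j).const_mul (A i j))).abs_le (ha.const_mul K)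
        fun x => hT.one x i
    rw [zero_sub, abs_neg] at h3
    calc _ ≤ K * a := h3
      _ ≤ K * ((1 + K₄) * γ) := by gcongr
      _ = _ := by ring
  calc _ ≤ ‖momentOne π xs‖ := norm_le_pi_norm (momentOne π xs) i
    _ ≤ k * (K * (1 + K₄) * γ) := (hk _).trans (by gcongr)
    _ = _ := by ring

/-- The third moments of the displacement are of the order of the square of the step size. -/
theorem exists_momentThree_le (hT : TaylorCoefficients P F N xs A B D C C' K) (hA : Coercive A m)
    (hm : 0 < m) (L : ℝ≥0) (s₂ s₄ K₄ : ℝ) :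
    ∃ K₃ : ℝ, ∀ γ π, ConcentratedLaw P F N xs L s₂ s₄ K₄ γ π →
      ∀ i j k, |momentThree π xs i j k| ≤ K₃ * γ ^ 2 := by
  obtain ⟨k₁, hk₁⟩ := exists_momentOne_le hT hA hm L s₂ s₄ K₄
  obtain ⟨k, hk0, hk⟩ := LinearMap.exists_norm_le_of_injective _ (hA.lyapunovThree_injective hm)
  set W : ℝ := (L + 1) ^ 4 * (27 * (1 + K₄ + s₄)) with hW
  -- Bounds c/γ in the third moment identity: the products F F z, the variation of the covariance
  -- times z, and the covariance at xs times the mean displacement.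
  set Q : ℝ := 3 * (L ^ 2 * (1 + 2 * K₄)) + 3 * (K * (1 + K₄)) + 3 * (‖C‖ * k₁) with hQ
  refine ⟨k * (3 * (K * K₄) + Q + W), fun γ π H i j o => ?_⟩
  obtain ⟨a2, ha2, h20, h21⟩ := H.hasMean_two
  obtain ⟨a3, ha3, h30, h31⟩ := H.hasMean_three
  obtain ⟨a4, ha4, h40, h41⟩ := H.hasMean_four
  have hγ := H.pos
  have hγ1 := H.le_one
  have hK := hT.nonneg
  have hK4 := H.nonneg
  have hs4 := H.noise.fourth_nonneg
  have hM : ∀ i, |momentOne π xs i| ≤ k₁ * γ := hk₁ γ π H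
  have hk1 : 0 ≤ k₁ := by
    have := (abs_nonneg _).trans (hM i)
    exact nonneg_of_mul_nonneg_left this hγ
  have hL0 : (0 : ℝ) ≤ L := L.2
  have hC : ∀ i j, |C i j| ≤ ‖C‖ := fun i j =>
    (norm_le_pi_norm (C i) j).trans (norm_le_pi_norm C i)
  have h2 : ‖lyapunovThree A (momentThree π xs)‖ ≤ (3 * (K * K₄) + Q + W) * γ ^ 2 := by
    have hpos : 0 ≤ (3 * (K * K₄) + Q + W) * γ ^ 2 := by positivity
    refine (pi_norm_le_iff_of_nonneg hpos).2 fun i => (pi_norm_le_iff_of_nonneg hpos).2 fun j =>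
      (pi_norm_le_iff_of_nonneg hpos).2 fun o => ?_
    obtain ⟨c, r, hc1, hc2, hr⟩ := H.third_moment hγ.ne' i j o
    have hlyap : HasMean π (fun x => ∑ l, (A i l * ((x - xs) l * (x - xs) j * (x - xs) o) +
        A j l * ((x - xs) i * (x - xs) l * (x - xs) o) +
        A o l * ((x - xs) i * (x - xs) j * (x - xs) l)))
        (lyapunovThree A (momentThree π xs) i j o) :=
      HasMean.sum fun l => (((H.three_hasMean l j o).const_mul (A i l)).add
        ((H.three_hasMean i l o).const_mul (A j l))).add
        ((H.three_hasMean i j l).const_mul (A o l))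
    -- Linearizing F costs K‖z‖² times two factors z, hence a fourth moment, of order γ².
    have e1 := (hc1.sub hlyap).abs_le (ha4.const_mul (3 * K)) fun x => by
      have b1 := abs_mul_apply_le (abs_mul_apply_le (hT.one x i) j) o
      have b2 := abs_mul_apply_le (abs_mul_apply_le (hT.one x j) i) o
      have b3 := abs_mul_apply_le (abs_mul_apply_le (hT.one x o) i) j
      refine le_trans (le_of_eq ?_) ((abs_add_three _ _ _).trans
        ((add_le_add (add_le_add b1 b2) b3).trans (le_of_eq (by ring))))
      congr 1
      simp only [Finset.sum_add_distrib, sub_mul, Finset.sum_mul]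
      ring_nf
    have hr' : |r| ≤ W := hr.trans (H.weight_pow_four.2.trans (by
      rw [hW]
      have : ∫ x, ‖x - xs‖ ^ 4 ∂π ≤ K₄ := H.four_le.trans
        (mul_le_of_le_one_right hK4 (pow_le_one₀ hγ.le hγ1))
      gcongr))
    have e2 := (hc2.sub ((((H.one_hasMean o).const_mul (C i j)).add
      ((H.one_hasMean j).const_mul (C i o))).add ((H.one_hasMean i).const_mul (C j o)))).abs_le
      ((ha3.const_mul (3 * L ^ 2)).add (ha2.const_mul (3 * K))) fun x => by
        have q : ∀ i j o, |F x i * F x j * (x - xs) o + (covTensor P N x i j - C i j) * (x - xs) o|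
            ≤ L ^ 2 * ‖x - xs‖ ^ 3 + K * ‖x - xs‖ ^ 2 := fun i j o => by
          refine (abs_add_le _ _).trans (add_le_add ?_ ?_)
          · refine abs_mul_apply_le ?_ o
            rw [abs_mul, ← mul_pow, sq]
            exact mul_le_mul (H.abs_apply_le x i) (H.abs_apply_le x j) (abs_nonneg _)
              (by positivity)
          · exact abs_mul_apply_le (n := 1) (by simpa using hT.cov_zero x i j) o
        refine le_trans (le_of_eq ?_) ((abs_add_three _ _ _).trans
          ((add_le_add (add_le_add (q i j o) (q i o j)) (q j o i)).trans (le_of_eq (by ring))))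
        congr 1
        ring
    have e3 : ∀ i j o, |C i j * ∫ x, (x - xs) o ∂π| ≤ ‖C‖ * (k₁ * γ) := fun i j o => by
      rw [abs_mul]
      exact mul_le_mul (hC i j) (hM o) (abs_nonneg _) (norm_nonneg _)
    have hc : |c| ≤ Q * γ := by
      have f1 := abs_le.1 e2
      have f2 := abs_le.1 (e3 i j o)
      have f3 := abs_le.1 (e3 i o j)
      have f4 := abs_le.1 (e3 j o i)
      have f5 : 3 * L ^ 2 * a3 + 3 * K * a2 ≤
          3 * L ^ 2 * ((1 + 2 * K₄) * γ) + 3 * K * ((1 + K₄) * γ) := by gcongr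
      have f6 : Q * γ = 3 * L ^ 2 * ((1 + 2 * K₄) * γ) + 3 * K * ((1 + K₄) * γ) +
          3 * (‖C‖ * (k₁ * γ)) := by rw [hQ]; ring
      rw [f6, abs_le]
      constructor <;> linarith
    have g1 : |γ * c| ≤ Q * γ ^ 2 := by
      rw [abs_mul, abs_of_pos hγ]
      calc γ * |c| ≤ γ * (Q * γ) := by gcongr
        _ = _ := by ring
    have g2 : |γ ^ 2 * r| ≤ W * γ ^ 2 := by
      rw [abs_mul, abs_of_nonneg (by positivity), mul_comm]
      gcongr
    have g3 : 3 * K * a4 ≤ 3 * (K * K₄) * γ ^ 2 := by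
      calc 3 * K * a4 ≤ 3 * K * (K₄ * γ ^ 2) := by gcongr
        _ = _ := by ring
    have g1 := abs_le.1 g1
    have g2 := abs_le.1 g2
    have e1 := abs_le.1 e1
    rw [Real.norm_eq_abs, abs_le]
    constructor <;> linarith
  calc _ ≤ ‖momentThree π xs i j‖ := norm_le_pi_norm (momentThree π xs i j) o
    _ ≤ ‖momentThree π xs i‖ := norm_le_pi_norm (momentThree π xs i) j
    _ ≤ ‖momentThree π xs‖ := norm_le_pi_norm (momentThree π xs) i
    _ ≤ k * ((3 * (K * K₄) + Q + W) * γ ^ 2) := (hk _).trans (by gcongr)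
    _ = _ := by ring

end ConcentratedLaw

end Expansion

/-! ### First-order expansions of the second moments and of the mean -/

section Expansion

variable {d : ℕ} {Ω : Type*} [MeasurableSpace Ω]

namespace ConcentratedLaw

variable {P : Measure Ω} {F : Eucl d → Eucl d} {N : Eucl d → Ω → Eucl d} {xs : Eucl d} {L : ℝ≥0}
  {s₂ s₄ K₄ γ : ℝ} {π : Measure (Eucl d)} {A : Fin d → Fin d → ℝ}
  {B : Fin d → Fin d → Fin d → ℝ} {D : Fin d → Fin d → Fin d → Fin d → ℝ}
  {C : Fin d → Fin d → ℝ} {C' : Fin d → Fin d → Fin d → ℝ} {K m : ℝ}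

/-- First order expansion of the second moments of the displacement in the step size. -/
theorem exists_momentTwo_sub_le (hT : TaylorCoefficients P F N xs A B D C C' K)
    (hA : Coercive A m) (hm : 0 < m) (L : ℝ≥0) (s₂ s₄ K₄ : ℝ) :
    ∃ (S : Fin d → Fin d → ℝ) (K₂ : ℝ), ∀ γ π, ConcentratedLaw P F N xs L s₂ s₄ K₄ γ π →
      ∀ i j, |momentTwo π xs i j - γ * S i j| ≤ K₂ * γ ^ 2 := by
  obtain ⟨k₁, hk₁⟩ := exists_momentOne_le hT hA hm L s₂ s₄ K₄
  obtain ⟨k₃, hk₃⟩ := exists_momentThree_le hT hA hm L s₂ s₄ K₄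
  have hinj := hA.lyapunovTwo_injective hm
  obtain ⟨k, hk0, hk⟩ := LinearMap.exists_norm_le_of_injective _ hinj
  -- S solves the Lyapunov equation whose right side is the noise covariance at xs; γS is the
  -- limiting covariance to first order.
  obtain ⟨S, hS⟩ := LinearMap.exists_eq_of_injective _ hinj C
  obtain ⟨b, hb⟩ : ∃ b : ℝ, b = ∑ i, ∑ k, ∑ l, |B i k l| := ⟨_, rfl⟩
  obtain ⟨c', hc'⟩ : ∃ c' : ℝ, c' = ∑ i, ∑ j, ∑ k, |C' i j k| := ⟨_, rfl⟩
  -- The terms are the cubic Taylor remainder times z, the quadratic Taylor part against third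
  -- moments, and the error in c = C + O(γ). Absolute values are taken because k₁ and k₃ have a
  -- known sign only once a law is given.
  obtain ⟨Q, hQ⟩ : ∃ Q : ℝ, Q = 2 * (K * K₄) + 2 * (b * |k₃|) +
      ((L ^ 2 + K) * (1 + K₄) + c' * |k₁|) :=
    ⟨_, rfl⟩
  refine ⟨S, k * Q, fun γ π H i j => ?_⟩
  obtain ⟨a2, ha2, h20, h21⟩ := H.hasMean_two
  obtain ⟨a4, ha4, h40, h41⟩ := H.hasMean_four
  have hγ := H.pos
  have := H.probπ
  have hK := hT.nonneg
  have hK4 := H.nonneg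
  have hL0 : (0 : ℝ) ≤ L := L.2
  have hb0 : 0 ≤ b := hb ▸ Finset.sum_nonneg fun _ _ => 
    Finset.sum_nonneg fun _ _ => Finset.sum_nonneg fun _ _ => abs_nonneg _
  have hc0 : 0 ≤ c' := hc' ▸ Finset.sum_nonneg fun _ _ => 
    Finset.sum_nonneg fun _ _ => Finset.sum_nonneg fun _ _ => abs_nonneg _
  have hM1 : ∀ i, |momentOne π xs i| ≤ |k₁| * γ := fun i =>
    (hk₁ γ π H i).trans (by gcongr; exact le_abs_self _)
  have hM3 : ∀ i j k, |momentThree π xs i j k| ≤ |k₃| * γ ^ 2 := fun i j k =>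
    (hk₃ γ π H i j k).trans (by gcongr; exact le_abs_self _)
  have hBs : ∀ i j, |∑ k, ∑ l, B i k l * momentThree π xs k l j| ≤ b * (|k₃| * γ ^ 2) :=
    fun i j => (abs_sum_sum_mul_le fun k l => hM3 k l j).trans (by
      rw [hb]
      refine mul_le_mul_of_nonneg_right ?_ (by positivity)
      exact Finset.single_le_sum (f := fun i => ∑ k, ∑ l, |B i k l|)
        (fun i _ => Finset.sum_nonneg fun _ _ => Finset.sum_nonneg fun _ _ => abs_nonneg _)
        (Finset.mem_univ i))
  have hCs : ∀ i j, |∑ k, C' i j k * momentOne π xs k| ≤ c' * (|k₁| * γ) :=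
    fun i j => (abs_sum_mul_le hM1).trans (by
      rw [hc']
      refine mul_le_mul_of_nonneg_right ?_ (by positivity)
      exact (Finset.single_le_sum (f := fun j => ∑ k, |C' i j k|)
        (fun i _ => by positivity) (Finset.mem_univ j)).trans
        (Finset.single_le_sum (f := fun i => ∑ j, ∑ k, |C' i j k|)
        (fun i _ => by positivity) (Finset.mem_univ i)))
  have hQ0 : 0 ≤ Q * γ ^ 2 := by rw [hQ]; positivity
  have h2 : ‖lyapunovTwo A (momentTwo π xs - γ • S)‖ ≤ Q * γ ^ 2 := by
    rw [map_sub, map_smul, hS]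
    refine (pi_norm_le_iff_of_nonneg hQ0).2 fun i => (pi_norm_le_iff_of_nonneg hQ0).2 fun j => ?_
    obtain ⟨c, hc1, hc2⟩ := H.second_moment hγ.ne' i j
    have hlyap : HasMean π (fun x => ∑ l, (A i l * ((x - xs) l * (x - xs) j) +
        A j l * ((x - xs) i * (x - xs) l))) (lyapunovTwo A (momentTwo π xs) i j) :=
      HasMean.sum fun l => ((H.two_hasMean l j).const_mul (A i l)).add
        ((H.two_hasMean i l).const_mul (A j l))
    have hB3 : ∀ i j, HasMean π (fun x => ∑ k, ∑ l, B i k l *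
        ((x - xs) k * (x - xs) l * (x - xs) j)) (∑ k, ∑ l, B i k l * momentThree π xs k l j) :=
      fun i j => HasMean.sum fun k => HasMean.sum fun l =>
        (H.three_hasMean k l j).const_mul (B i k l)
    have e1 := (hc1.sub ((hlyap.add (hB3 i j)).add (hB3 j i))).abs_le
      (ha4.const_mul (2 * K)) fun x => by
        have b1 := abs_mul_apply_le (hT.two x i) j
        have b2 := abs_mul_apply_le (hT.two x j) i
        refine le_trans (le_of_eq ?_) ((abs_add_le _ _).trans
          ((add_le_add b1 b2).trans (le_of_eq (by ring))))
        congr 1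
        simp only [Finset.sum_add_distrib, sub_mul, add_mul, Finset.sum_mul, mul_assoc,
          mul_comm ((x - xs) i)]
        ring
    have e2 := (hc2.sub ((HasMean.const (μ := π) (C i j)).add (HasMean.sum fun k =>
      (H.one_hasMean k).const_mul (C' i j k)))).abs_le (ha2.const_mul (L ^ 2 + K)) fun x => by
        have b1 : |F x i * F x j| ≤ L ^ 2 * ‖x - xs‖ ^ 2 := by
          rw [abs_mul, ← mul_pow, sq]
          exact mul_le_mul (H.abs_apply_le x i) (H.abs_apply_le x j) (abs_nonneg _)
            (by positivity)
        refine le_trans (le_of_eq ?_) ((abs_add_le _ _).trans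
          ((add_le_add b1 (hT.cov_one x i j)).trans (le_of_eq (by ring))))
        congr 1
        ring
    have e3 : |c - C i j| ≤ ((L ^ 2 + K) * (1 + K₄) + c' * |k₁|) * γ := by
      have f1 := abs_le.1 e2
      have f2 := abs_le.1 (hCs i j)
      have f3 : (L ^ 2 + K) * a2 ≤ (L ^ 2 + K) * ((1 + K₄) * γ) := by gcongr
      have f4 : ((L ^ 2 + K) * (1 + K₄) + c' * |k₁|) * γ =
        (L ^ 2 + K) * ((1 + K₄) * γ) + c' * (|k₁| * γ) := by ring
      unfold momentOne at f2
      rw [f4, abs_le]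
      constructor <;> linarith
    have g1 : |γ * c - γ * C i j| ≤ ((L ^ 2 + K) * (1 + K₄) + c' * |k₁|) * γ ^ 2 := by
      rw [← mul_sub, abs_mul, abs_of_pos hγ]
      calc γ * |c - C i j| ≤ γ * (((L ^ 2 + K) * (1 + K₄) + c' * |k₁|) * γ) := by gcongr
        _ = _ := by ring
    have g3 : 2 * K * a4 ≤ 2 * (K * K₄) * γ ^ 2 := by
      calc 2 * K * a4 ≤ 2 * K * (K₄ * γ ^ 2) := by gcongr
        _ = _ := by ring
    have g1 := abs_le.1 g1
    have e1 := abs_le.1 e1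
    have g4 := abs_le.1 (hBs i j)
    have g5 := abs_le.1 (hBs j i)
    have g6 : Q * γ ^ 2 = 2 * (K * K₄) * γ ^ 2 + 2 * (b * (|k₃| * γ ^ 2)) +
        ((L ^ 2 + K) * (1 + K₄) + c' * |k₁|) * γ ^ 2 := by rw [hQ]; ring
    simp only [Pi.sub_apply, Pi.smul_apply, smul_eq_mul]
    rw [g6, Real.norm_eq_abs, abs_le]
    constructor <;> linarith
  have h3 := (hk _).trans (mul_le_mul_of_nonneg_left h2 hk0)
  calc _ ≤ ‖(momentTwo π xs - γ • S) i‖ := norm_le_pi_norm ((momentTwo π xs - γ • S) i) j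
    _ ≤ ‖momentTwo π xs - γ • S‖ := norm_le_pi_norm (momentTwo π xs - γ • S) i
    _ ≤ k * (Q * γ ^ 2) := h3
    _ = _ := by ring

/-- First order expansion of the mean displacement in the step size. -/
theorem exists_momentOne_sub_le (hT : TaylorCoefficients P F N xs A B D C C' K)
    (hA : Coercive A m) (hm : 0 < m) (L : ℝ≥0) (s₂ s₄ K₄ : ℝ) :
    ∃ (Δ : Fin d → ℝ) (K₁ : ℝ), ∀ γ π, ConcentratedLaw P F N xs L s₂ s₄ K₄ γ π →
      ∀ i, |momentOne π xs i - γ * Δ i| ≤ K₁ * γ ^ 2 := by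
  obtain ⟨S, k₂, hk₂⟩ := exists_momentTwo_sub_le hT hA hm L s₂ s₄ K₄
  obtain ⟨k₃, hk₃⟩ := exists_momentThree_le hT hA hm L s₂ s₄ K₄
  have hinj := hA.lyapunovOne_injective hm
  obtain ⟨k, hk0, hk⟩ := LinearMap.exists_norm_le_of_injective _ hinj
  -- The order γ part of E F = 0, namely AΔ + B : S = 0, where B is half the second derivative of F
  -- at xs.
  obtain ⟨Δ, hΔ⟩ := LinearMap.exists_eq_of_injective _ hinj
    fun i => - ∑ j, ∑ k, B i j k * S j k
  obtain ⟨b, hb⟩ : ∃ b : ℝ, b = ∑ i, ∑ k, ∑ l, |B i k l| := ⟨_, rfl⟩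
  obtain ⟨e, he⟩ : ∃ e : ℝ, e = ∑ i, ∑ j, ∑ k, ∑ l, |D i j k l| := ⟨_, rfl⟩
  obtain ⟨Q, hQ⟩ : ∃ Q : ℝ, Q = K * K₄ + b * |k₂| + e * |k₃| := ⟨_, rfl⟩
  refine ⟨Δ, k * Q, fun γ π H i => ?_⟩
  obtain ⟨a4, ha4, h40, h41⟩ := H.hasMean_four
  have hγ := H.pos
  have hK := hT.nonneg
  have hK4 := H.nonneg
  have hb0 : 0 ≤ b := hb ▸ Finset.sum_nonneg fun _ _ => 
    Finset.sum_nonneg fun _ _ => Finset.sum_nonneg fun _ _ => abs_nonneg _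
  have he0 : 0 ≤ e := he ▸ Finset.sum_nonneg fun _ _ => Finset.sum_nonneg fun _ _ =>
    Finset.sum_nonneg fun _ _ => Finset.sum_nonneg fun _ _ => abs_nonneg _
  have hQ0 : 0 ≤ Q * γ ^ 2 := by rw [hQ]; positivity
  have hM2 : ∀ i j, |momentTwo π xs i j - γ * S i j| ≤ |k₂| * γ ^ 2 := fun i j =>
    (hk₂ γ π H i j).trans (by gcongr; exact le_abs_self _)
  have hM3 : ∀ i j k, |momentThree π xs i j k| ≤ |k₃| * γ ^ 2 := fun i j k =>
    (hk₃ γ π H i j k).trans (by gcongr; exact le_abs_self _)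
  have h2 : ‖lyapunovOne A (momentOne π xs - γ • Δ)‖ ≤ Q * γ ^ 2 := by
    rw [map_sub, map_smul, hΔ]
    refine (pi_norm_le_iff_of_nonneg hQ0).2 fun i => ?_
    -- F is expanded to third order so that the remainder is a fourth moment; stopping at second
    -- order would leave E‖z‖³, which is not known to be O(γ²).
    have e1 := ((H.first_moment hγ.ne' i).sub (((HasMean.sum fun j =>
      (H.one_hasMean j).const_mul (A i j)).add (HasMean.sum fun j => HasMean.sum fun k =>
      (H.two_hasMean j k).const_mul (B i j k))).add (HasMean.sum fun j => HasMean.sum fun k =>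
      HasMean.sum fun l => (H.three_hasMean j k l).const_mul (D i j k l)))).abs_le
      (ha4.const_mul K) fun x => hT.three x i
    have e2 : |∑ j, ∑ k, B i j k * (momentTwo π xs j k - γ * S j k)| ≤ b * (|k₂| * γ ^ 2) :=
      (abs_sum_sum_mul_le hM2).trans (by
        rw [hb]
        refine mul_le_mul_of_nonneg_right ?_ (by positivity)
        exact Finset.single_le_sum (f := fun i => ∑ k, ∑ l, |B i k l|)
          (fun i _ => Finset.sum_nonneg fun _ _ => Finset.sum_nonneg fun _ _ => abs_nonneg _)
          (Finset.mem_univ i))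
    have e3 : |∑ j, ∑ k, ∑ l, D i j k l * momentThree π xs j k l| ≤ e * (|k₃| * γ ^ 2) :=
      (abs_sum_sum_sum_mul_le hM3).trans (by
        rw [he]
        refine mul_le_mul_of_nonneg_right ?_ (by positivity)
        exact Finset.single_le_sum (f := fun i => ∑ j, ∑ k, ∑ l, |D i j k l|)
          (fun i _ => Finset.sum_nonneg fun _ _ => Finset.sum_nonneg fun _ _ =>
            Finset.sum_nonneg fun _ _ => abs_nonneg _)
          (Finset.mem_univ i))
    have e4 : ∑ j, ∑ k, B i j k * (momentTwo π xs j k - γ * S j k) =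
        ∑ j, ∑ k, B i j k * momentTwo π xs j k - γ * ∑ j, ∑ k, B i j k * S j k := by
      simp only [mul_sub, Finset.sum_sub_distrib, Finset.mul_sum, mul_left_comm γ]
    have g3 : K * a4 ≤ K * K₄ * γ ^ 2 := by
      calc K * a4 ≤ K * (K₄ * γ ^ 2) := by gcongr
        _ = _ := by ring
    have g6 : Q * γ ^ 2 = K * K₄ * γ ^ 2 + b * (|k₂| * γ ^ 2) + e * (|k₃| * γ ^ 2) := by
      rw [hQ]; ring
    rw [e4] at e2
    have e1 := abs_le.1 e1
    have e2 := abs_le.1 e2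
    have e3 := abs_le.1 e3
    have e5 : lyapunovOne A (momentOne π xs) i = ∑ j, A i j * momentOne π xs j := rfl
    simp only [Pi.sub_apply, Pi.smul_apply, smul_eq_mul]
    rw [g6, Real.norm_eq_abs, e5, abs_le]
    unfold momentOne
    unfold momentTwo at e2
    unfold momentThree at e3
    constructor <;> linarith
  have h3 := (hk _).trans (mul_le_mul_of_nonneg_left h2 hk0)
  calc _ ≤ ‖momentOne π xs - γ • Δ‖ := norm_le_pi_norm (momentOne π xs - γ • Δ) i
    _ ≤ k * (Q * γ ^ 2) := h3
    _ = _ := by ring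

theorem integrable_id (H : ConcentratedLaw P F N xs L s₂ s₄ K₄ γ π) :
    Integrable (fun x => x) π := by
  have := H.probπ
  refine ((integrable_const (‖xs‖ + 1)).add H.four).mono' (by fun_prop)
    (Filter.Eventually.of_forall fun x => ?_)
  have h1 : ‖x‖ ≤ ‖xs‖ + ‖x - xs‖ := by
    simpa using norm_add_le xs (x - xs)
  have h2 : ‖x - xs‖ ≤ 1 + ‖x - xs‖ ^ 4 := by
    rcases le_total ‖x - xs‖ 1 with h | h
    · have : 0 ≤ ‖x - xs‖ ^ 4 := by positivity
      linarith
    · linarith [le_self_pow₀ h (n := 4) (by norm_num)]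
  simp only [Pi.add_apply]
  linarith

theorem integral_sub_apply (H : ConcentratedLaw P F N xs L s₂ s₄ K₄ γ π) (i : Fin d) :
    ((∫ x, x ∂π) - xs) i = momentOne π xs i := by
  have := H.probπ
  have h1 : ∫ x, (x - xs) ∂π = (∫ x, x ∂π) - xs := by
    rw [integral_sub H.integrable_id (integrable_const xs)]; simp
  rw [← h1]
  exact ((EuclideanSpace.proj (𝕜 := ℝ) i).integral_comp_comm
    (H.integrable_id.sub (integrable_const xs))).symm

end ConcentratedLaw

theorem norm_le_card_mul {v : Eucl d} {t : ℝ} (h : ∀ i, |v i| ≤ t) : ‖v‖ ≤ d * t := by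
  have hz : v = ∑ j, v j • EuclideanSpace.single j (1 : ℝ) := by
    simpa using ((EuclideanSpace.basisFun (Fin d) ℝ).sum_repr v).symm
  rw [hz]
  refine (norm_sum_le _ _).trans ?_
  simp only [norm_smul, PiLp.norm_single, norm_one, mul_one]
  refine (Finset.sum_le_card_nsmul _ _ t fun i _ => h i).trans (by simp)

/-- The law of a step from x is the image of the law of the whole field under a function of
evaluation at x, measurable for the product σ-algebra. -/
theorem sgdaKernel_eq_of_identDistrib {P : Measure Ω} [IsProbabilityMeasure P]
    {F : Eucl d → Eucl d} (hF : Measurable F) {U : ℕ → Eucl d → Ω → Eucl d} {σ : ℝ}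
    (hU : OracleNoise P U σ) (γ : ℝ) (t : ℕ) : sgdaKernel P F (U t) γ = sgdaKernel P F (U 0) γ := by
  ext x : 1
  rw [sgdaKernel_eq_map hF (hU.measurable t), sgdaKernel_eq_map hF (hU.measurable 0)]
  have h := (hU.identDistrib t).comp (u := fun f : Eucl d → Eucl d => x - γ • (F x + f x))
    (by fun_prop)
  exact h.map_eq

end Expansion

/-! ### The main theorem -/

theorem mainTheorem5 {d : ℕ} {Ω : Type*} [MeasurableSpace Ω] (P : Measure Ω)
    [IsProbabilityMeasure P] (F : Eucl d → Eucl d) (U : ℕ → Eucl d → Ω → Eucl d)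
    (xs : Eucl d) (m σ κ G : ℝ) (L : ℝ≥0)
    (hxs : F xs = 0) (hm : 0 < m) (hmono : WeakQuasiStronglyMonotone F xs m 0)
    (hF : SmoothOperator F L) (hσ : 0 < σ) (hU : OracleNoise P U σ)
    (hdens : PositiveDensityComponent P U) (hreg : RegularNoise P U κ G) :
    ∃ θ : ℝ, 0 < θ ∧ ∃ π : ℝ → Measure (Eucl d),
      (∀ γ : ℝ, 0 < γ → γ < θ →
        SGDAStationary P F U γ (π γ) ∧
        (∀ ν : Measure (Eucl d), SGDAStationary P F U γ ν → ν = π γ) ∧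
        Integrable (fun x => x) (π γ)) ∧
      (∃ (Δ : Eucl d) (K : ℝ), ∀ γ : ℝ, 0 < γ → γ < θ →
        ‖(∫ x, x ∂(π γ)) - xs - γ • Δ‖ ≤ K * γ ^ 2) ∧
      (∃ K : ℝ, ∀ γ : ℝ, 0 < γ → 2 * γ < θ →
        ‖(2 : ℝ) • (∫ x, x ∂(π γ)) - (∫ x, x ∂(π (2 * γ))) - xs‖ ≤ K * γ ^ 2) := by
  have hN := hU.centeredNoise hreg
  have hFm : Measurable F := hF.lipschitz.continuous.measurable
  -- The three bounds give γ ≤ 1, γm ≤ 1 and γL² ≤ m; L² + 1 allows L = 0.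
  set θ : ℝ := min 1 (min (1 / m) (m / (L ^ 2 + 1))) with hθ
  have hθ0 : 0 < θ := by positivity
  have hθγ : ∀ γ, 0 < γ → γ < θ → γ ≤ 1 ∧ γ * m ≤ 1 ∧ γ * L ^ 2 ≤ m := fun γ h0 h => by
    have h1 := h.trans_le (min_le_left _ _)
    have h2 := h.trans_le ((min_le_right _ _).trans (min_le_left _ _))
    have h3 := h.trans_le ((min_le_right _ _).trans (min_le_right _ _))
    rw [lt_div_iff₀ hm] at h2
    rw [lt_div_iff₀ (by positivity)] at h3
    exact ⟨h1.le, h2.le, by linarith⟩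
  set K₄ : ℝ := 2 * (32 * (σ ^ 2) ^ 2 / m + 3 * κ ^ 4) / m
  have hex : ∀ γ, ∃ π : Measure (Eucl d), 0 < γ → γ < θ →
      ConcentratedLaw P F (U 0) xs L (σ ^ 2) (κ ^ 4) K₄ γ π ∧
      Kernel.Invariant (sgdaKernel P F (U 0) γ) π ∧
      ∀ ν : Measure (Eucl d), IsProbabilityMeasure ν →
        Kernel.Invariant (sgdaKernel P F (U 0) γ) ν → ν = π := by
    intro γ
    by_cases h : 0 < γ ∧ γ < θ
    · obtain ⟨h1, h2, h3⟩ := hθγ γ h.1 h.2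
      obtain ⟨π, hπ, hinv, hint, hle, huniq⟩ := exists_unique_invariant_sgdaKernel hxs hm hmono
        hF.lipschitz hN hdens h.1 h1 h2 h3
      exact ⟨π, fun _ _ => ⟨⟨⟨inferInstance, hπ, hxs, hF.lipschitz, hN,
        (hreg.cov_contDiff 0).continuous.measurable, hint,
        map_prod_of_invariant hFm hN.measurable hinv⟩, h.1, h1, hle⟩, hinv, huniq⟩⟩
    -- The zero measure is a default for step sizes outside (0, θ), about which nothing is claimed.
    · exact ⟨0, fun h1 h2 => absurd ⟨h1, h2⟩ h⟩
  choose π hπ using hex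
  obtain ⟨A, B, D, K, hK, hAT⟩ := hF.exists_taylor hxs
  obtain ⟨C, C', K', hK', hCT⟩ := hreg.exists_taylor xs
  have hA : Coercive A m := hmono.coercive hK fun x i => (hAT x i).1
  have hT : TaylorCoefficients P F (U 0) xs A B D C C' (K + K') :=
    { nonneg := by positivity
      one := fun x i => (hAT x i).1.trans (by gcongr; linarith)
      two := fun x i => (hAT x i).2.1.trans (by gcongr; linarith)
      three := fun x i => (hAT x i).2.2.trans (by gcongr; linarith)
      cov_zero := fun x i j => (hCT x i j).1.trans (by gcongr; linarith)
      cov_one := fun x i j => (hCT x i j).2.trans (by gcongr; linarith) }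
  obtain ⟨Δ, k, hk⟩ := ConcentratedLaw.exists_momentOne_sub_le hT hA hm L (σ ^ 2) (κ ^ 4) K₄
  set Δ' : Eucl d := WithLp.toLp 2 Δ with hΔ'
  have hexp : ∀ γ : ℝ, 0 < γ → γ < θ →
      ‖(∫ x, x ∂(π γ)) - xs - γ • Δ'‖ ≤ d * k * γ ^ 2 := fun γ h0 h => by
    have H := (hπ γ h0 h).1
    rw [mul_assoc]
    refine norm_le_card_mul fun i => ?_
    have e : ((∫ x, x ∂(π γ)) - xs - γ • Δ') i = momentOne (π γ) xs i - γ * Δ i := by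
      rw [← H.integral_sub_apply]; rfl
    rw [e]
    exact hk γ _ H i
  -- The factor 6 is 2 + 2²: twice the error at γ plus the error at 2γ.
  refine ⟨θ, hθ0, π, fun γ h0 h => ?_, ⟨Δ', d * k, hexp⟩, 6 * (d * k), fun γ h0 h => ?_⟩
  · obtain ⟨H, hinv, huniq⟩ := hπ γ h0 h
    exact ⟨⟨H.probπ, fun t => by rwa [sgdaKernel_eq_of_identDistrib hFm hU]⟩,
      fun ν hν => huniq ν hν.isProbabilityMeasure (hν.invariant 0), H.integrable_id⟩
  · have h1 := hexp γ h0 (by linarith)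
    have h2 := hexp (2 * γ) (by linarith) h
    have e : (2 : ℝ) • (∫ x, x ∂(π γ)) - (∫ x, x ∂(π (2 * γ))) - xs =
        (2 : ℝ) • ((∫ x, x ∂(π γ)) - xs - γ • Δ') -
          ((∫ x, x ∂(π (2 * γ))) - xs - (2 * γ) • Δ') := by
      module
    rw [e]
    refine (norm_sub_le _ _).trans ?_
    rw [norm_smul, Real.norm_of_nonneg zero_le_two]
    linarith
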